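/- **Model.** Let $S$ be a set of $n$ pairwise disjoint closed horizontal segments in the plane. For $R\subseteq S$, the vertical visibility map (trapezoidal map) $\mathcal T(R)$ is the subdivision of the plane by the segments of $R$ and by the vertical lines drawn upwards and downwards from each end-point of a segment of $R$ until they hit another segment of $R$ (or to infinity). Its faces are called trapezoids; they are open, possibly unbounded. The conflict graph of $R$ is the bipartite graph that joins each trapezoid of $\mathcal T(R)$ to the segments of $S\setminus R$ that meet it. The conflict-graph based randomized incremental construction (RIC) inserts the segments one by one in a uniformly random order, starting from $R=\emptyset$, and maintains the conflict graph. Its number of structural changes (its work) $W$ is the total number of edges created in the conflict graph during the $n$ insertions. **Theorem.** There are inputs $S_n$ $(n\in\mathbb N)$ as follows. $S_n$ consists of $n$ pairwise disjoint horizontal segments, no two of which have end-points with the same abscissa. It splits into an upper pile of $\lfloor n/2\rfloor$ and a lower pile of $\lceil n/2\rceil$ segments; all upper segments are above all lower ones, and for every end-point of a lower segment, every upper segment passes vertically above this end-point while no segment of the lower pile does. Let $W_n$ be the work on $S_n$. Then: 1. There are absolute constants $K,K'>0$ such that for every function $c:\mathbb N\to[0,\infty)$ with $c(n)=o(\sqrt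 n)$ and all sufficiently large $n$, $$\Pr\big[\,W_n\ \ge\ K\,c(n)\,n\log\log n\,\big]\ \ge\ K'\,e^{-20\,c(n)} .$$ 2. In particular (for $c(n)=\frac{\log n}{40}$), there are constants $K,K'>0$ such that for all sufficiently large $n$, $$\Pr\big[\,W_n\ \ge\ K\,n\log n\log\log n\,\big]\ \ge\ \frac{K'}{\sqrt n}.$$ 3. This rules out inverse polynomial concentration around the expected work: for all constants $C,\varepsilon>0$ and all sufficiently large $n$, $$\Pr[\,W_n\ge C\,n\log n\,]\ \ge\ n^{-\varepsilon}\qquad\text{and}\qquad \Pr\big[\,W_n\ge C\,\mathbb E[W_n]\,\big]\ \ge\ n^{-\varepsilon}.$$ Here $\log$ is the natural logarithm. -/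

import Mathlib

open Filter Asymptotics Topology

/-! # Vertical visibility maps of horizontal segments and their conflict graphs -/

namespace VisibilityRIC

/-- A closed horizontal segment of positive length in the plane:
`[l, r] × {y}`. -/
structure HSegment where
  l : ℝ
  r : ℝ
  y : ℝ
  l_lt_r : l < r

/-- The points of a segment. -/
def HSegment.carrier (s : HSegment) : Set (ℝ × ℝ) :=
  {p | s.l ≤ p.1 ∧ p.1 ≤ s.r ∧ p.2 = s.y}

/-- `x` is the abscissa of one of the two end-points of `s`. -/
def HSegment.IsEndAbscissa (s : HSegment) (x : ℝ) : Prop := x = s.l ∨ x = s.r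

/-- The segments are pairwise disjoint (as closed point sets). -/
def NonIntersecting {n : ℕ} (S : Fin n → HSegment) : Prop :=
  ∀ i j, i ≠ j → Disjoint (S i).carrier (S j).carrier

/-- No two end-points of different segments lie on a common vertical line. -/
def GeneralPosition {n : ℕ} (S : Fin n → HSegment) : Prop :=
  ∀ i j, i ≠ j → ∀ x, (S i).IsEndAbscissa x → ¬ (S j).IsEndAbscissa x

/-- The input splits into an upper pile `U` of `⌊n/2⌋` segments and a lower pile `Uᶜ`
of `⌈n/2⌉` segments. Every segment of `U` is above every segment of the lower pile, and every
end-point of a lower segment sees all segments of `U` vertically: each segment of `U`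
passes above that end-point and no segment of the lower pile does. -/
def IsTwoPiles {n : ℕ} (S : Fin n → HSegment) : Prop :=
  ∃ U : Finset (Fin n), U.card = n / 2 ∧
    (∀ u ∈ U, ∀ b ∉ U, (S b).y < (S u).y) ∧
    ∀ b ∉ U, ∀ x, (S b).IsEndAbscissa x →
      (∀ u ∈ U, (S u).l ≤ x ∧ x ≤ (S u).r) ∧
      ∀ b' ∉ U, (S b).y < (S b').y → ¬ ((S b').l ≤ x ∧ x ≤ (S b').r)

/-- An axis-parallel box, possibly unbounded. For horizontal segments all trapezoids of the
vertical visibility map are of this form. -/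
@[ext] structure Box where
  left : EReal
  right : EReal
  bot : EReal
  top : EReal

/-- The open region of a box. -/
def Box.region (σ : Box) : Set (ℝ × ℝ) :=
  {p | σ.left < (p.1 : EReal) ∧ (p.1 : EReal) < σ.right ∧
    σ.bot < (p.2 : EReal) ∧ (p.2 : EReal) < σ.top}

/-- A segment conflicts with a box if it meets the open region of the box. -/
def Conflicts (s : HSegment) (σ : Box) : Prop := (s.carrier ∩ σ.region).Nonempty

/-- The horizontal line at height `h` bounding a box is either at infinity (`h = inf`) or
is carried by a segment of `R` that spans the whole side. -/
def HorizontalSide {n : ℕ} (S : Fin n → HSegment) (R : Finset (Fin n)) (σ : Box)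
    (inf h : EReal) : Prop :=
  h = inf ∨ ∃ i ∈ R, ((S i).y : EReal) = h ∧
    ((S i).l : EReal) ≤ σ.left ∧ σ.right ≤ ((S i).r : EReal)

/-- A vertical side of a box is either at infinity (`v = inf`) or it lies on the vertical
line through an end-point of a segment of `R` that belongs to this (closed) side. -/
def VerticalSide {n : ℕ} (S : Fin n → HSegment) (R : Finset (Fin n)) (σ : Box)
    (inf v : EReal) : Prop :=
  v = inf ∨ ∃ i ∈ R, (((S i).l : EReal) = v ∨ ((S i).r : EReal) = v) ∧
    σ.bot ≤ ((S i).y : EReal) ∧ ((S i).y : EReal) ≤ σ.top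

/-- The trapezoids of the vertical visibility map (trapezoidal map) of the segments
`S i`, `i ∈ R`: the faces of the subdivision of the plane by these segments and by
the vertical lines drawn from their end-points, upwards and downwards, until they hit another
segment of `R` (or to infinity). These are the nonempty open boxes that meet no segment of `R` and
each side of which is at infinity, or carried by a segment of `R` (top and bottom), or by
the vertical line through an end-point of a segment of `R` (left and right). -/
def trapezoids {n : ℕ} (S : Fin n → HSegment) (R : Finset (Fin n)) : Set Box :=
  {σ | σ.left < σ.right ∧ σ.bot < σ.top ∧
    HorizontalSide S R σ ⊤ σ.top ∧ HorizontalSide S R σ ⊥ σ.bot ∧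
    VerticalSide S R σ ⊥ σ.left ∧ VerticalSide S R σ ⊤ σ.right ∧
    ∀ i ∈ R, ¬ Conflicts (S i) σ}

/-- The edges of the conflict graph after the segments in `R` have been inserted: the pairs of
a trapezoid of the current map and an uninserted segment that meets it. -/
def conflictGraph {n : ℕ} (S : Fin n → HSegment) (R : Finset (Fin n)) :
    Set (Box × Fin n) :=
  {e | e.1 ∈ trapezoids S R ∧ e.2 ∉ R ∧ Conflicts (S e.2) e.1}

theorem trapezoids_finite {n : ℕ} (S : Fin n → HSegment) (R : Finset (Fin n)) :
    (trapezoids S R).Finite := by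
  let A : Set EReal := {⊤, ⊥} ∪ (Set.range (fun i => ((S i).y : EReal)) ∪
    (Set.range (fun i => ((S i).l : EReal)) ∪ Set.range (fun i => ((S i).r : EReal))))
  have hA : A.Finite :=
    (Set.toFinite _).union ((Set.finite_range _).union
      ((Set.finite_range _).union (Set.finite_range _)))
  have hP := ((hA.prod hA).prod (hA.prod hA)).image
    (fun q : (EReal × EReal) × (EReal × EReal) => Box.mk q.1.1 q.1.2 q.2.1 q.2.2)
  refine hP.subset ?_
  rintro σ ⟨-, -, ht, hb, hl, hr, -⟩
  refine ⟨((σ.left, σ.right), (σ.bot, σ.top)), ⟨⟨?_, ?_⟩, ⟨?_, ?_⟩⟩, rfl⟩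
  · rcases hl with h | ⟨i, -, h | h, -⟩
    · exact Or.inl (Or.inr h)
    · exact Or.inr (Or.inr (Or.inl ⟨i, h⟩))
    · exact Or.inr (Or.inr (Or.inr ⟨i, h⟩))
  · rcases hr with h | ⟨i, -, h | h, -⟩
    · exact Or.inl (Or.inl h)
    · exact Or.inr (Or.inr (Or.inl ⟨i, h⟩))
    · exact Or.inr (Or.inr (Or.inr ⟨i, h⟩))
  · rcases hb with h | ⟨i, -, h, -⟩
    · exact Or.inl (Or.inr h)
    · exact Or.inr (Or.inl ⟨i, h⟩)
  · rcases ht with h | ⟨i, -, h, -⟩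
    · exact Or.inl (Or.inl h)
    · exact Or.inr (Or.inl ⟨i, h⟩)

/-- The conflict graph is finite, so counting its edges by `Set.ncard` is meaningful. -/
theorem conflictGraph_finite {n : ℕ} (S : Fin n → HSegment) (R : Finset (Fin n)) :
    (conflictGraph S R).Finite :=
  ((trapezoids_finite S R).prod (Set.finite_univ (α := Fin n))).subset
    fun _ he => ⟨he.1, Set.mem_univ _⟩

/-- The set of the first `k` segments in the insertion order `π 0, π 1, …, π (n-1)`. -/
def inserted {n : ℕ} (π : Equiv.Perm (Fin n)) (k : ℕ) : Finset (Fin n) :=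
  (Finset.univ.filter fun i : Fin n => (i : ℕ) < k).map π.toEmbedding

/-- The structural changes (work) of the conflict-graph based incremental construction with
insertion order `π`: the total number of edges created in the conflict graph
over all `n` insertions. -/
noncomputable def work {n : ℕ} (S : Fin n → HSegment) (π : Equiv.Perm (Fin n)) : ℕ :=
  ∑ k ∈ Finset.range n,
    (conflictGraph S (inserted π (k + 1)) \ conflictGraph S (inserted π k)).ncard

/-- Probability of an event under a uniformly random insertion order. -/
noncomputable def prob {n : ℕ} (E : Equiv.Perm (Fin n) → Prop) : ℝ :=
  (Nat.card {π : Equiv.Perm (Fin n) // E π} : ℝ) / (Nat.card (Equiv.Perm (Fin n)) : ℝ)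

/-- Expected work under a uniformly random insertion order. -/
noncomputable def expectedWork {n : ℕ} (S : Fin n → HSegment) : ℝ :=
  (∑ π : Equiv.Perm (Fin n), (work S π : ℝ)) / (Nat.card (Equiv.Perm (Fin n)) : ℝ)

end VisibilityRIC

open VisibilityRIC

/-! In `pile` the lower segments form a staircase with disjoint shadows, and every upper segment
overhangs everything below it. The gap between the staircase and the lowest inserted upper segment
is cut by the vertical lines from the lower end-points. If `t` lower segments are present when an
upper segment becomes the lowest one, each upper segment beneath it acquires at least `t` new
conflicts (`card_le_ncard_created`). Inserting `t` lower segments and then `r` upper ones in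
descending order, while the `q` lowest upper segments wait, thus costs at least `r * q * t` edges
(`mul_le_work_of_schedule`).

Such an order is not too rare. Allowing any lower segment in the first `t` places and then any
member of the `j`-th of `r` blocks of about `n / (8 r)` upper segments gives probability at least
`(1/4)^t (1/(32 r))^r` (`schedule_prob`). With `t ≈ c` and `r ≈ log log n` the work is of order `c n
log log n`. When `c log log n > log n`, `r²` is small against `c`, so the probability is at least
`exp(-2 - 20 c)` (`tail_of_bounds`). When `c log log n ≤ log n`, the tail bound holds with
certainty: every order sorts the lower pile as quicksort does and creates of order `n log n` edges
(`mul_le_work`, resting on `card_depth_lt`).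

For the comparison with the mean, `ncard_created_le` bounds the conflicts created for a pair `(x,
s)` by 6 if no inserted segment separates them, plus twice the number of inserted lower segments if
`x` becomes the lowest upper one. By exchangeability both contributions sum to harmonic sums, so the
mean is `O(n log n)` (`expectedWork_le`). Taking `c` a small multiple of `log n` turns `exp(-20 c)`
into an inverse polynomial while the work exceeds the mean by a factor of order `log log n`. -/

namespace VisibilityRIC

/-! ### Boxes and the segments that meet or bound them. -/

/-- A segment meets a nonempty box iff its height lies strictly between the heights of the box
and its abscissae overlap the open horizontal range of the box. -/
theorem conflicts_iff {s : HSegment} {σ : Box} (hσ : σ.left < σ.right) :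
    Conflicts s σ ↔ σ.bot < (s.y : EReal) ∧ (s.y : EReal) < σ.top ∧
      σ.left < (s.r : EReal) ∧ (s.l : EReal) < σ.right := by
  constructor
  · rintro ⟨⟨a, b⟩, ⟨h1, h2, h3⟩, h4, h5, h6, h7⟩
    simp only at h1 h2 h3 h4 h5 h6 h7
    subst h3
    exact ⟨h6, h7, h4.trans_le (EReal.coe_le_coe_iff.2 h2),
      (EReal.coe_le_coe_iff.2 h1).trans_lt h5⟩
  · rintro ⟨h1, h2, h3, h4⟩
    have h : max σ.left (s.l : EReal) < min σ.right (s.r : EReal) :=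
      max_lt (lt_min hσ h3) (lt_min h4 (EReal.coe_lt_coe_iff.2 s.l_lt_r))
    obtain ⟨x, hx1, hx2⟩ := EReal.lt_iff_exists_real_btwn.1 h
    rw [max_lt_iff] at hx1
    rw [lt_min_iff] at hx2
    exact ⟨(x, s.y), ⟨EReal.coe_le_coe_iff.1 hx1.2.le, EReal.coe_le_coe_iff.1 hx2.2.le, rfl⟩,
      hx1.1, hx2.1, h1, h2⟩

/-- The segment `s` carries the top or the bottom side of `σ`, or one of its end-points defines
the left or the right side. -/
def IsSide (s : HSegment) (σ : Box) : Prop :=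
  (((s.y : EReal) = σ.top ∨ (s.y : EReal) = σ.bot) ∧
      (s.l : EReal) ≤ σ.left ∧ σ.right ≤ (s.r : EReal)) ∨
    (((s.l : EReal) = σ.left ∨ (s.r : EReal) = σ.left ∨
      (s.l : EReal) = σ.right ∨ (s.r : EReal) = σ.right) ∧
      σ.bot ≤ (s.y : EReal) ∧ (s.y : EReal) ≤ σ.top)

/-- The segment `s` meets the closure of the box `σ`. -/
def Touches (s : HSegment) (σ : Box) : Prop :=
  σ.bot ≤ (s.y : EReal) ∧ (s.y : EReal) ≤ σ.top ∧ σ.left ≤ (s.r : EReal) ∧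
    (s.l : EReal) ≤ σ.right

theorem IsSide.touches {s : HSegment} {σ : Box} (h : IsSide s σ) (h1 : σ.left < σ.right)
    (h2 : σ.bot < σ.top) : Touches s σ := by
  have h3 : (s.l : EReal) < s.r := EReal.coe_lt_coe_iff.2 s.l_lt_r
  rcases h with ⟨h | h, h4, h5⟩ | ⟨h | h | h | h, h4, h5⟩
  · exact ⟨h ▸ h2.le, h.le, h1.le.trans h5, h4.trans h1.le⟩
  · exact ⟨h.ge, h ▸ h2.le, h1.le.trans h5, h4.trans h1.le⟩
  · exact ⟨h4, h5, h ▸ h3.le, h ▸ h1.le⟩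
  · exact ⟨h4, h5, h.ge, h3.le.trans (h ▸ h1.le)⟩
  · exact ⟨h4, h5, h1.le.trans (h ▸ h3.le), h.le⟩
  · exact ⟨h4, h5, h ▸ h1.le, h ▸ h3.le⟩

/-! ### Trapezoids of general families: new faces, disjointness, covering. -/

section Geometry

variable {n : ℕ} {S : Fin n → HSegment} {R : Finset (Fin n)}

theorem HorizontalSide.of_insert {x : Fin n} {σ : Box} {inf h : EReal}
    (hs : HorizontalSide S (insert x R) σ inf h) :
    HorizontalSide S R σ inf h ∨ (((S x).y : EReal) = h ∧
      ((S x).l : EReal) ≤ σ.left ∧ σ.right ≤ ((S x).r : EReal)) := by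
  rcases hs with hs | ⟨i, hi, hs⟩
  · exact Or.inl (Or.inl hs)
  · rcases Finset.mem_insert.1 hi with rfl | hi
    · exact Or.inr hs
    · exact Or.inl (Or.inr ⟨i, hi, hs⟩)

theorem VerticalSide.of_insert {x : Fin n} {σ : Box} {inf v : EReal}
    (hs : VerticalSide S (insert x R) σ inf v) :
    VerticalSide S R σ inf v ∨ ((((S x).l : EReal) = v ∨ ((S x).r : EReal) = v) ∧
      σ.bot ≤ ((S x).y : EReal) ∧ ((S x).y : EReal) ≤ σ.top) := by
  rcases hs with hs | ⟨i, hi, hs⟩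
  · exact Or.inl (Or.inl hs)
  · rcases Finset.mem_insert.1 hi with rfl | hi
    · exact Or.inr hs
    · exact Or.inl (Or.inr ⟨i, hi, hs⟩)

/-- A trapezoid created by the insertion of `x` has `x` as one of its sides. -/
theorem isSide_of_new {x : Fin n} {σ : Box} (h : σ ∈ trapezoids S (insert x R))
    (h' : σ ∉ trapezoids S R) : IsSide (S x) σ := by
  obtain ⟨h1, h2, ht, hb, hl, hr, hc⟩ := h
  rcases ht.of_insert with ht | ht
  swap
  · exact Or.inl ⟨Or.inl ht.1, ht.2⟩
  rcases hb.of_insert with hb | hb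
  swap
  · exact Or.inl ⟨Or.inr hb.1, hb.2⟩
  rcases hl.of_insert with hl | ⟨hl, hl'⟩
  swap
  · exact Or.inr ⟨by tauto, hl'⟩
  rcases hr.of_insert with hr | ⟨hr, hr'⟩
  swap
  · exact Or.inr ⟨by tauto, hr'⟩
  exact absurd ⟨h1, h2, ht, hb, hl, hr, fun i hi => hc i (Finset.mem_insert_of_mem hi)⟩ h'

theorem eq_of_mem_carrier (hS : NonIntersecting S) {i j : Fin n} {p : ℝ × ℝ}
    (hi : p ∈ (S i).carrier) (hj : p ∈ (S j).carrier) : i = j := by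
  by_contra h
  exact Set.disjoint_left.1 (hS i j h) hi hj

/-- The segments sharing a height and an abscissa coincide. -/
theorem eq_of_common_point (hS : NonIntersecting S) {i j : Fin n} {v : EReal}
    (hy : ((S i).y : EReal) = (S j).y) (h1 : ((S i).l : EReal) ≤ v) (h2 : v ≤ ((S i).r : EReal))
    (h3 : ((S j).l : EReal) ≤ v) (h4 : v ≤ ((S j).r : EReal)) : i = j := by
  induction v with
  | bot => simp at h1
  | top => simp at h2
  | coe v =>
    norm_cast at *
    exact eq_of_mem_carrier hS (p := (v, (S i).y)) ⟨h1, h2, rfl⟩ ⟨h3, h4, hy⟩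

/-- The segment carrying the top of `σ` spans the abscissa of `p` and runs above `p`; if `τ` reached
higher, that segment would cut through `τ`. -/
theorem top_le_of_common {σ τ : Box} (hσ : σ ∈ trapezoids S R) (hτ : τ ∈ trapezoids S R)
    {p : ℝ × ℝ} (h1 : p ∈ σ.region) (h2 : p ∈ τ.region) : τ.top ≤ σ.top := by
  by_contra h
  push Not at h
  rcases hσ.2.2.1 with h3 | ⟨i, hi, h3, h4, h5⟩
  · rw [h3] at h; exact not_top_lt h
  · refine hτ.2.2.2.2.2.2 i hi ((conflicts_iff hτ.1).2 ⟨?_, ?_, ?_, ?_⟩)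
    · rw [h3]; exact h2.2.2.1.trans h1.2.2.2
    · rwa [h3]
    · exact h2.1.trans (h1.2.1.trans_le h5)
    · exact (h4.trans_lt h1.1).trans h2.2.1

theorem bot_le_of_common {σ τ : Box} (hσ : σ ∈ trapezoids S R) (hτ : τ ∈ trapezoids S R)
    {p : ℝ × ℝ} (h1 : p ∈ σ.region) (h2 : p ∈ τ.region) : σ.bot ≤ τ.bot := by
  by_contra h
  push Not at h
  rcases hσ.2.2.2.1 with h3 | ⟨i, hi, h3, h4, h5⟩
  · rw [h3] at h; exact not_lt_bot h
  · refine hτ.2.2.2.2.2.2 i hi ((conflicts_iff hτ.1).2 ⟨?_, ?_, ?_, ?_⟩)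
    · rwa [h3]
    · rw [h3]; exact h1.2.2.1.trans h2.2.2.2
    · exact h2.1.trans (h1.2.1.trans_le h5)
    · exact (h4.trans_lt h1.1).trans h2.2.1

/-- No end-point of a segment of `R` lies on the boundary of a trapezoid of `R` with an abscissa
strictly between those of the vertical sides. -/
theorem no_end_inside (hS : NonIntersecting S) {τ : Box} (hτ : τ ∈ trapezoids S R) {i : Fin n}
    (hi : i ∈ R) {v : EReal} (hv : ((S i).l : EReal) = v ∨ ((S i).r : EReal) = v)
    (hb : τ.bot ≤ ((S i).y : EReal)) (ht : ((S i).y : EReal) ≤ τ.top) (h1 : τ.left < v)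
    (h2 : v < τ.right) : False := by
  have hlr : ((S i).l : EReal) < (S i).r := EReal.coe_lt_coe_iff.2 (S i).l_lt_r
  have hlv : ((S i).l : EReal) ≤ v := by rcases hv with h | h <;> rw [← h]; exact hlr.le
  have hvr : v ≤ ((S i).r : EReal) := by rcases hv with h | h <;> rw [← h]; exact hlr.le
  -- If the end-point lay on the top or bottom side, the segment carrying that side would contain
  -- it, hence be `S i` itself; but that segment reaches both vertical sides, so its end-points are
  -- not strictly inside.
  have key : ∀ j ∈ R, ((S j).y : EReal) = (S i).y → ((S j).l : EReal) ≤ τ.left →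
      τ.right ≤ ((S j).r : EReal) → False := by
    intro j _ hy hl hr
    have : j = i := eq_of_common_point hS hy (hl.trans h1.le) (h2.le.trans hr) hlv hvr
    subst this
    rcases hv with h | h
    · exact absurd (h ▸ hl) (not_le.2 h1)
    · exact absurd (h ▸ hr) (not_le.2 h2)
  rcases hb.lt_or_eq with hb | hb
  · rcases ht.lt_or_eq with ht | ht
    · exact hτ.2.2.2.2.2.2 i hi ((conflicts_iff hτ.1).2
        ⟨hb, ht, h1.trans_le hvr, hlv.trans_lt h2⟩)
    · rcases hτ.2.2.1 with h | ⟨j, hj, h, h'⟩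
      · rw [h] at ht; simp at ht
      · exact key j hj (h.trans ht.symm) h'.1 h'.2
  · rcases hτ.2.2.2.1 with h | ⟨j, hj, h, h'⟩
    · rw [h] at hb; simp at hb
    · exact key j hj (h.trans hb) h'.1 h'.2

/-- The top and bottom comparisons put the end-point defining the left side of `σ` into the closed
vertical range of `τ`, where `no_end_inside` forbids it to lie strictly between the vertical sides.
-/
theorem left_le_of_common (hS : NonIntersecting S) {σ τ : Box} (hσ : σ ∈ trapezoids S R)
    (hτ : τ ∈ trapezoids S R) {p : ℝ × ℝ} (h1 : p ∈ σ.region) (h2 : p ∈ τ.region) :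
    σ.left ≤ τ.left := by
  by_contra h
  push Not at h
  have hb := bot_le_of_common hτ hσ h2 h1
  have ht := top_le_of_common hτ hσ h2 h1
  rcases hσ.2.2.2.2.1 with h3 | ⟨i, hi, h3, h4, h5⟩
  · rw [h3] at h; exact not_lt_bot h
  · exact no_end_inside hS hτ hi h3 (hb.trans h4) (h5.trans ht) h (h1.1.trans h2.2.1)

theorem right_le_of_common (hS : NonIntersecting S) {σ τ : Box} (hσ : σ ∈ trapezoids S R)
    (hτ : τ ∈ trapezoids S R) {p : ℝ × ℝ} (h1 : p ∈ σ.region) (h2 : p ∈ τ.region) :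
    τ.right ≤ σ.right := by
  by_contra h
  push Not at h
  have hb := bot_le_of_common hτ hσ h2 h1
  have ht := top_le_of_common hτ hσ h2 h1
  rcases hσ.2.2.2.2.2.1 with h3 | ⟨i, hi, h3, h4, h5⟩
  · rw [h3] at h; exact not_top_lt h
  · exact no_end_inside hS hτ hi h3 (hb.trans h4) (h5.trans ht) (h2.1.trans h1.2.1) h

/-- Distinct trapezoids of a vertical visibility map are disjoint. -/
theorem eq_of_common (hS : NonIntersecting S) {σ τ : Box} (hσ : σ ∈ trapezoids S R)
    (hτ : τ ∈ trapezoids S R) {p : ℝ × ℝ} (h1 : p ∈ σ.region) (h2 : p ∈ τ.region) :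
    σ = τ :=
  Box.ext
    ((left_le_of_common hS hσ hτ h1 h2).antisymm (left_le_of_common hS hτ hσ h2 h1))
    ((right_le_of_common hS hτ hσ h2 h1).antisymm (right_le_of_common hS hσ hτ h1 h2))
    ((bot_le_of_common hσ hτ h1 h2).antisymm (bot_le_of_common hτ hσ h2 h1))
    ((top_le_of_common hτ hσ h2 h1).antisymm (top_le_of_common hσ hτ h1 h2))

/-- Two trapezoids that overlap horizontally and are met by a common segment coincide. -/
theorem eq_of_conflicts (hS : NonIntersecting S) {σ τ : Box} (hσ : σ ∈ trapezoids S R)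
    (hτ : τ ∈ trapezoids S R) {s : HSegment} (h1 : Conflicts s σ) (h2 : Conflicts s τ)
    (h : max σ.left τ.left < min σ.right τ.right) : σ = τ := by
  rw [conflicts_iff hσ.1] at h1
  rw [conflicts_iff hτ.1] at h2
  obtain ⟨x, hx1, hx2⟩ := EReal.lt_iff_exists_real_btwn.1 h
  rw [max_lt_iff] at hx1
  rw [lt_min_iff] at hx2
  exact eq_of_common hS hσ hτ (p := (x, s.y)) ⟨hx1.1, hx2.1, h1.1, h1.2.1⟩
    ⟨hx1.2, hx2.2, h2.1, h2.2.1⟩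

/-- Makes `Box.left` injective on the trapezoids met by a fixed segment, so that they can be counted
through the abscissae of their sides. -/
theorem eq_of_left_eq (hS : NonIntersecting S) {σ τ : Box} (hσ : σ ∈ trapezoids S R)
    (hτ : τ ∈ trapezoids S R) {s : HSegment} (h1 : Conflicts s σ) (h2 : Conflicts s τ)
    (h : σ.left = τ.left) : σ = τ :=
  eq_of_conflicts hS hσ hτ h1 h2 (by
    rw [h, max_self, lt_min_iff]; exact ⟨h ▸ hσ.1, hτ.1⟩)

theorem eq_of_right_eq (hS : NonIntersecting S) {σ τ : Box} (hσ : σ ∈ trapezoids S R)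
    (hτ : τ ∈ trapezoids S R) {s : HSegment} (h1 : Conflicts s σ) (h2 : Conflicts s τ)
    (h : σ.right = τ.right) : σ = τ :=
  eq_of_conflicts hS hσ hτ h1 h2 (by
    rw [h, min_self, max_lt_iff]; exact ⟨h ▸ hσ.1, hτ.1⟩)

/-- A point off the segments of `R`, and not vertically aligned with an end-point of one of them,
lies in a trapezoid. -/
theorem exists_trapezoid (S : Fin n → HSegment) (R : Finset (Fin n)) (p : ℝ × ℝ)
    (h1 : ∀ i ∈ R, p ∉ (S i).carrier)
    (h2 : ∀ i ∈ R, p.1 ≠ (S i).l ∧ p.1 ≠ (S i).r) :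
    ∃ σ ∈ trapezoids S R, p ∈ σ.region := by
  classical
  obtain ⟨px, py⟩ := p
  simp only at h2
  -- Shoot vertically from `p` to the nearest segments, then move sideways to the nearest end-points
  -- within that height range. An empty `inf` is `⊤` and an empty `sup` is `⊥`, which produces the
  -- sides at infinity.
  let T := R.filter fun i => (S i).l ≤ px ∧ px ≤ (S i).r ∧ py < (S i).y
  let B := R.filter fun i => (S i).l ≤ px ∧ px ≤ (S i).r ∧ (S i).y < py
  let top : EReal := T.inf fun i => ((S i).y : EReal)
  let bot : EReal := B.sup fun i => ((S i).y : EReal)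
  let ends := R.image (fun i => ((S i).l, (S i).y)) ∪ R.image (fun i => ((S i).r, (S i).y))
  -- The height range is closed so that the end-points of the segments carrying top and bottom take
  -- part; this is why those segments span their sides.
  let EL := ends.filter fun q => bot ≤ (q.2 : EReal) ∧ (q.2 : EReal) ≤ top ∧ q.1 < px
  let ER := ends.filter fun q => bot ≤ (q.2 : EReal) ∧ (q.2 : EReal) ≤ top ∧ px < q.1
  let left : EReal := EL.sup fun q => (q.1 : EReal)
  let right : EReal := ER.inf fun q => (q.1 : EReal)
  have hbp : bot < py := (Finset.sup_lt_iff (EReal.bot_lt_coe _)).2 fun i hi =>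
    EReal.coe_lt_coe_iff.2 (Finset.mem_filter.1 hi).2.2.2
  have hpt : (py : EReal) < top := (Finset.lt_inf_iff (EReal.coe_lt_top _)).2 fun i hi =>
    EReal.coe_lt_coe_iff.2 (Finset.mem_filter.1 hi).2.2.2
  have hlp : left < px := (Finset.sup_lt_iff (EReal.bot_lt_coe _)).2 fun i hi =>
    EReal.coe_lt_coe_iff.2 (Finset.mem_filter.1 hi).2.2.2
  have hpr : (px : EReal) < right := (Finset.lt_inf_iff (EReal.coe_lt_top _)).2 fun i hi =>
    EReal.coe_lt_coe_iff.2 (Finset.mem_filter.1 hi).2.2.2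
  have hLl : ∀ i ∈ R, bot ≤ ((S i).y : EReal) → ((S i).y : EReal) ≤ top → (S i).l < px →
      ((S i).l : EReal) ≤ left := fun i hi h3 h4 h5 =>
    Finset.le_sup (f := fun q : ℝ × ℝ => (q.1 : EReal)) (b := ((S i).l, (S i).y))
      (Finset.mem_filter.2 ⟨Finset.mem_union_left _ (Finset.mem_image_of_mem _ hi), h3, h4, h5⟩)
  have hLr : ∀ i ∈ R, bot ≤ ((S i).y : EReal) → ((S i).y : EReal) ≤ top → (S i).r < px →
      ((S i).r : EReal) ≤ left := fun i hi h3 h4 h5 =>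
    Finset.le_sup (f := fun q : ℝ × ℝ => (q.1 : EReal)) (b := ((S i).r, (S i).y))
      (Finset.mem_filter.2 ⟨Finset.mem_union_right _ (Finset.mem_image_of_mem _ hi), h3, h4, h5⟩)
  have hRl : ∀ i ∈ R, bot ≤ ((S i).y : EReal) → ((S i).y : EReal) ≤ top → px < (S i).l →
      right ≤ ((S i).l : EReal) := fun i hi h3 h4 h5 =>
    Finset.inf_le (f := fun q : ℝ × ℝ => (q.1 : EReal)) (b := ((S i).l, (S i).y))
      (Finset.mem_filter.2 ⟨Finset.mem_union_left _ (Finset.mem_image_of_mem _ hi), h3, h4, h5⟩)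
  have hRr : ∀ i ∈ R, bot ≤ ((S i).y : EReal) → ((S i).y : EReal) ≤ top → px < (S i).r →
      right ≤ ((S i).r : EReal) := fun i hi h3 h4 h5 =>
    Finset.inf_le (f := fun q : ℝ × ℝ => (q.1 : EReal)) (b := ((S i).r, (S i).y))
      (Finset.mem_filter.2 ⟨Finset.mem_union_right _ (Finset.mem_image_of_mem _ hi), h3, h4, h5⟩)
  have hends : ∀ q ∈ ends, ∃ i ∈ R, ((S i).l = q.1 ∨ (S i).r = q.1) ∧ (S i).y = q.2 := by
    intro q hq
    rcases Finset.mem_union.1 hq with hq | hq <;> obtain ⟨i, hi, rfl⟩ := Finset.mem_image.1 hq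
    · exact ⟨i, hi, Or.inl rfl, rfl⟩
    · exact ⟨i, hi, Or.inr rfl, rfl⟩
  refine ⟨⟨left, right, bot, top⟩, ⟨hlp.trans hpr, hbp.trans hpt, ?_, ?_, ?_, ?_, ?_⟩,
    hlp, hpr, hbp, hpt⟩
  · rcases T.eq_empty_or_nonempty with h | h
    · exact Or.inl (by simp only [top, h, Finset.inf_empty])
    · obtain ⟨i, hi, h3⟩ := Finset.exists_mem_eq_inf T h fun i => ((S i).y : EReal)
      obtain ⟨hi, h4, h5, h6⟩ := Finset.mem_filter.1 hi
      have hb : bot ≤ ((S i).y : EReal) := h3 ▸ (hbp.trans hpt).le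
      exact Or.inr ⟨i, hi, h3.symm, hLl i hi hb h3.ge (lt_of_le_of_ne h4 (h2 i hi).1.symm),
        hRr i hi hb h3.ge (lt_of_le_of_ne h5 (h2 i hi).2)⟩
  · rcases B.eq_empty_or_nonempty with h | h
    · exact Or.inl (by simp only [bot, h, Finset.sup_empty])
    · obtain ⟨i, hi, h3⟩ := Finset.exists_mem_eq_sup B h fun i => ((S i).y : EReal)
      obtain ⟨hi, h4, h5, h6⟩ := Finset.mem_filter.1 hi
      have ht : ((S i).y : EReal) ≤ top := h3 ▸ (hbp.trans hpt).le
      exact Or.inr ⟨i, hi, h3.symm, hLl i hi h3.le ht (lt_of_le_of_ne h4 (h2 i hi).1.symm),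
        hRr i hi h3.le ht (lt_of_le_of_ne h5 (h2 i hi).2)⟩
  · rcases EL.eq_empty_or_nonempty with h | h
    · exact Or.inl (by simp only [left, h, Finset.sup_empty])
    · obtain ⟨q, hq, h3⟩ := Finset.exists_mem_eq_sup EL h fun q => (q.1 : EReal)
      obtain ⟨hq, h4, h5, h6⟩ := Finset.mem_filter.1 hq
      obtain ⟨i, hi, h7, h8⟩ := hends q hq
      exact Or.inr ⟨i, hi, by
        change _ = EL.sup _ ∨ _ = EL.sup _
        rw [h3, EReal.coe_eq_coe_iff, EReal.coe_eq_coe_iff]; exact h7, h8 ▸ h4, h8 ▸ h5⟩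
  · rcases ER.eq_empty_or_nonempty with h | h
    · exact Or.inl (by simp only [right, h, Finset.inf_empty])
    · obtain ⟨q, hq, h3⟩ := Finset.exists_mem_eq_inf ER h fun q => (q.1 : EReal)
      obtain ⟨hq, h4, h5, h6⟩ := Finset.mem_filter.1 hq
      obtain ⟨i, hi, h7, h8⟩ := hends q hq
      exact Or.inr ⟨i, hi, by
        change _ = ER.inf _ ∨ _ = ER.inf _
        rw [h3, EReal.coe_eq_coe_iff, EReal.coe_eq_coe_iff]; exact h7, h8 ▸ h4, h8 ▸ h5⟩
  · intro i hi hc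
    obtain ⟨h3, h4, h5, h6⟩ := (conflicts_iff (hlp.trans hpr)).1 hc
    simp only at h3 h4 h5 h6
    have h7 : px < (S i).r := by
      by_contra h
      exact absurd (hLr i hi h3.le h4.le (lt_of_le_of_ne (not_lt.1 h) (h2 i hi).2.symm))
        (not_le.2 h5)
    have h8 : (S i).l < px := by
      by_contra h
      exact absurd (hRl i hi h3.le h4.le (lt_of_le_of_ne (not_lt.1 h) (h2 i hi).1))
        (not_le.2 h6)
    rcases lt_trichotomy (S i).y py with h | h | h
    · exact absurd (Finset.le_sup (f := fun i => ((S i).y : EReal))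
        (Finset.mem_filter.2 ⟨hi, h8.le, h7.le, h⟩)) (not_le.2 h3)
    · exact h1 i hi ⟨h8.le, h7.le, h.symm⟩
    · exact absurd (Finset.inf_le (f := fun i => ((S i).y : EReal))
        (Finset.mem_filter.2 ⟨hi, h8.le, h7.le, h⟩)) (not_le.2 h4)

end Geometry

/-! ### The two-pile input. -/

/-- The input with two piles. The segment `i` has height `i`. The lower segments
`i < n - n / 2` have pairwise disjoint abscissae, increasing with the height; the upper segments
pass above all segments below them, extending further on both sides. -/
noncomputable def pile (n : ℕ) (i : Fin n) : HSegment where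
  l := if (i : ℕ) < n - n / 2 then 2 * (i : ℝ) else -((i : ℝ) + 1)
  r := if (i : ℕ) < n - n / 2 then 2 * (i : ℝ) + 1 else 2 * (n : ℝ) + i + 1
  y := i
  l_lt_r := by
    have := Nat.cast_nonneg (α := ℝ) (i : ℕ)
    have := Nat.cast_nonneg (α := ℝ) n
    split_ifs <;> linarith

variable {n : ℕ}

theorem pile_y (i : Fin n) : (pile n i).y = (i : ℕ) := rfl

theorem pile_y_lt {i j : Fin n} : (pile n i).y < (pile n j).y ↔ i < j := by
  rw [pile_y, pile_y, Nat.cast_lt, Fin.lt_def]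

theorem pile_of_lower {i : Fin n} (h : (i : ℕ) < n - n / 2) :
    (pile n i).l = 2 * (i : ℝ) ∧ (pile n i).r = 2 * (i : ℝ) + 1 := by
  simp [pile, h]

/-- An upper segment extends beyond every lower-indexed segment, on both sides. -/
theorem pile_wider {i j : Fin n} (hij : i < j) (hj : n - n / 2 ≤ (j : ℕ)) :
    (pile n j).l < (pile n i).l ∧ (pile n i).r < (pile n j).r := by
  have h1 : (i : ℝ) < (j : ℝ) := by exact_mod_cast hij
  have h2 := Nat.cast_nonneg (α := ℝ) (i : ℕ)
  have h3 : (j : ℝ) < (n : ℝ) := by exact_mod_cast j.2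
  simp only [pile, not_lt.2 hj, if_false]
  split_ifs <;> constructor <;> linarith

/-- A lower segment is to the left of the lower segments above it. -/
theorem pile_apart {i j : Fin n} (hij : i < j) (hj : (j : ℕ) < n - n / 2) :
    (pile n i).r < (pile n j).l := by
  have h1 : (i : ℕ) < n - n / 2 := lt_trans hij hj
  have h2 : (i : ℝ) + 1 ≤ (j : ℝ) := by exact_mod_cast hij
  rw [(pile_of_lower hj).1, (pile_of_lower h1).2]
  linarith

theorem pile_nonIntersecting (n : ℕ) : NonIntersecting (pile n) := by
  intro i j hij
  rw [Set.disjoint_left]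
  rintro p ⟨_, _, h1⟩ ⟨_, _, h2⟩
  rw [h1, pile_y, pile_y, Nat.cast_inj] at h2
  exact hij (Fin.ext h2)

/-- No end-point of a segment is vertically above or below a point of a segment of smaller
index. -/
theorem pile_end_not_mem {i j : Fin n} (hij : i < j) {x : ℝ} (hx : (pile n j).IsEndAbscissa x)
    (h1 : (pile n i).l ≤ x) (h2 : x ≤ (pile n i).r) : False := by
  have hi := (pile n i).l_lt_r
  have hj := (pile n j).l_lt_r
  rcases lt_or_ge (j : ℕ) (n - n / 2) with h | h
  · have := pile_apart hij h
    rcases hx with rfl | rfl <;> linarith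
  · have := pile_wider hij h
    rcases hx with rfl | rfl <;> linarith

theorem pile_generalPosition (n : ℕ) : GeneralPosition (pile n) := by
  have key : ∀ {i : Fin n} {x : ℝ}, (pile n i).IsEndAbscissa x →
      (pile n i).l ≤ x ∧ x ≤ (pile n i).r := by
    rintro i x (rfl | rfl)
    · exact ⟨le_rfl, (pile n i).l_lt_r.le⟩
    · exact ⟨(pile n i).l_lt_r.le, le_rfl⟩
  intro i j hij x hi hj
  rcases hij.lt_or_gt with h | h
  · exact pile_end_not_mem h hj (key hi).1 (key hi).2
  · exact pile_end_not_mem h hi (key hj).1 (key hj).2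

theorem card_upper (n : ℕ) :
    (Finset.univ.filter fun i : Fin n => n - n / 2 ≤ (i : ℕ)).card = n / 2 := by
  have h : (Finset.univ.filter fun i : Fin n => n - n / 2 ≤ (i : ℕ)).map Fin.valEmbedding =
      Finset.Ico (n - n / 2) n := by
    ext k
    simp only [Finset.mem_map, Finset.mem_filter, Finset.mem_univ, true_and,
      Fin.valEmbedding_apply, Finset.mem_Ico]
    exact ⟨fun ⟨i, h1, h2⟩ => h2 ▸ ⟨h1, i.2⟩, fun ⟨h1, h2⟩ => ⟨⟨k, h2⟩, h1, rfl⟩⟩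
  rw [← Finset.card_map, h, Nat.card_Ico]
  omega

theorem pile_isTwoPiles (n : ℕ) : IsTwoPiles (pile n) := by
  refine ⟨Finset.univ.filter fun i : Fin n => n - n / 2 ≤ (i : ℕ), card_upper n, ?_, ?_⟩
  · intro u hu b hb
    simp only [Finset.mem_filter, Finset.mem_univ, true_and, not_le] at hu hb
    exact pile_y_lt.2 (Fin.lt_def.2 (hb.trans_le hu))
  · intro b hb x hx
    simp only [Finset.mem_filter, Finset.mem_univ, true_and, not_le] at hb ⊢
    have hlr := (pile n b).l_lt_r
    refine ⟨fun u hu => ?_, fun b' hb' hy h => ?_⟩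
    · have := pile_wider (Fin.lt_def.2 (hb.trans_le hu)) hu
      rcases hx with rfl | rfl <;> constructor <;> linarith
    · have := pile_apart (pile_y_lt.1 hy) hb'
      rcases hx with rfl | rfl <;> linarith

/-! ### Upper bounds for the conflicts created by one insertion. -/

/-- The segments that separate `x` from `s`: a trapezoid cannot have `x` on its boundary and be
met by `s` once one of them is inserted. -/
def between (x s : Fin n) : Finset (Fin n) :=
  Finset.univ.filter fun y =>
    min x s < y ∧ y < max x s ∧ (n - n / 2 ≤ (y : ℕ) ∨ ((max x s : Fin n) : ℕ) < n - n / 2)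

theorem mem_between {x s y : Fin n} : y ∈ between x s ↔ min x s < y ∧ y < max x s ∧
    (n - n / 2 ≤ (y : ℕ) ∨ ((max x s : Fin n) : ℕ) < n - n / 2) := by
  simp [between]

/-- The height of `y` is strictly between two heights in the closed range of `σ`. Horizontally, an
upper `y` overhangs the lower-indexed of the two segments, while in the lower pile the shadow of `y`
lies between their shadows; either way it overlaps that of `σ`. -/
theorem conflicts_of_between {x s y : Fin n} (hy : y ∈ between x s) {σ : Box}
    (hσ : σ.left < σ.right) (hx : Touches (pile n x) σ) (hs : Conflicts (pile n s) σ) :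
    Conflicts (pile n y) σ := by
  rw [conflicts_iff hσ] at hs ⊢
  obtain ⟨hx1, hx2, hx3, hx4⟩ := hx
  obtain ⟨hs1, hs2, hs3, hs4⟩ := hs
  obtain ⟨h1, h2, h3⟩ := mem_between.1 hy
  have lo : ∀ z : Fin n, σ.bot ≤ ((pile n z).y : EReal) → z < y →
      σ.bot < ((pile n y).y : EReal) := fun z hz hzy =>
    hz.trans_lt (EReal.coe_lt_coe_iff.2 (pile_y_lt.2 hzy))
  have hi : ∀ z : Fin n, ((pile n z).y : EReal) ≤ σ.top → y < z →
      ((pile n y).y : EReal) < σ.top := fun z hz hzy =>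
    (EReal.coe_lt_coe_iff.2 (pile_y_lt.2 hzy)).trans_le hz
  have key : ∀ a b : Fin n, a < y → y < b →
      (n - n / 2 ≤ (y : ℕ) ∨ (b : ℕ) < n - n / 2) → σ.left ≤ ((pile n a).r : EReal) →
      ((pile n a).l : EReal) ≤ σ.right → ((pile n b).l : EReal) ≤ σ.right →
      σ.left < ((pile n y).r : EReal) ∧ ((pile n y).l : EReal) < σ.right := by
    intro a b ha hb h h4 h5 h6
    rcases h with h | h
    · have := pile_wider ha h
      exact ⟨h4.trans_lt (EReal.coe_lt_coe_iff.2 this.2),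
        (EReal.coe_lt_coe_iff.2 this.1).trans_le h5⟩
    · have h7 := pile_apart ha (lt_trans hb h)
      have h8 := pile_apart hb h
      exact ⟨h4.trans_lt (EReal.coe_lt_coe_iff.2 (h7.trans (pile n y).l_lt_r)),
        (EReal.coe_lt_coe_iff.2 ((pile n y).l_lt_r.trans h8)).trans_le h6⟩
  rcases le_total x s with h | h
  · rw [min_eq_left h] at h1
    rw [max_eq_right h] at h2 h3
    exact ⟨lo x hx1 h1, hi s hs2.le h2, key x s h1 h2 h3 hx3 hx4 hs4.le⟩
  · rw [min_eq_right h] at h1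
    rw [max_eq_left h] at h2 h3
    exact ⟨lo s hs1.le h1, hi x hx2 h2, key s x h1 h2 h3 hs3.le hs4.le hx4⟩

theorem not_mem_of_between {x s : Fin n} {R : Finset (Fin n)} {σ : Box}
    (hσ : σ ∈ trapezoids (pile n) R) (hx : Touches (pile n x) σ) (hs : Conflicts (pile n s) σ)
    {y : Fin n} (hy : y ∈ R) : y ∉ between x s := fun h =>
  hσ.2.2.2.2.2.2 y hy (conflicts_of_between h hσ.1 hx hs)

/-- The trapezoids created by the insertion of `x` that are met by `s`. -/
def created (R : Finset (Fin n)) (x s : Fin n) : Set Box :=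
  {σ | σ ∈ trapezoids (pile n) (insert x R) ∧ σ ∉ trapezoids (pile n) R ∧
    Conflicts (pile n s) σ}

theorem created_finite (R : Finset (Fin n)) (x s : Fin n) : (created R x s).Finite :=
  (trapezoids_finite (pile n) (insert x R)).subset fun _ h => h.1

/-- The inserted segments below `s` that are not separated from `s`. -/
def visibleBelow (R : Finset (Fin n)) (s : Fin n) : Finset (Fin n) :=
  R.filter fun i => i < s ∧ ∀ y ∈ R, y ∉ between i s

/-- If no end-point of `x` supports a vertical side, then `x` spans the top or bottom, and the left
side comes from some inserted `i`. As a bottom, `x` would have an end-point of a higher segment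
above it, which `pile_end_not_mem` excludes. As a top, `x` lies above `s`, and `i` must be visible
below `s`: an upper `i` above `s` would separate `x` from `s`, and a lower one would put all of `σ`
to the right of `s`. -/
theorem created_subset {R : Finset (Fin n)} {x s : Fin n} {σ : Box} (hs : s ∉ R) (hxs : x ≠ s)
    (hσ : σ ∈ created R x s) :
    (((pile n x).l : EReal) = σ.left ∨ ((pile n x).r : EReal) = σ.left ∨
      ((pile n x).l : EReal) = σ.right ∨ ((pile n x).r : EReal) = σ.right) ∨
    s < x ∧ ∃ i ∈ visibleBelow R s,
      ((pile n i).l : EReal) = σ.left ∨ ((pile n i).r : EReal) = σ.left := by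
  obtain ⟨h1, h2, h3⟩ := hσ
  have hside := isSide_of_new h1 h2
  have htx := hside.touches h1.1 h1.2.1
  rcases hside with ⟨hyx, hlx, hrx⟩ | ⟨h, -⟩
  swap
  · exact Or.inl h
  have h4 := (conflicts_iff h1.1).1 h3
  rcases h1.2.2.2.2.1 with hl | ⟨i, hi, hl, hib, hit⟩
  · rw [hl] at hlx; simp at hlx
  rcases eq_or_ne i x with rfl | hix
  · exact Or.inl (by tauto)
  have hiR : i ∈ R := (Finset.mem_insert.1 hi).resolve_left hix
  have his : i ≠ s := fun h => hs (h ▸ hiR)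
  rcases hyx with hyx | hyx
  · have hix' : i < x := by
      rw [← hyx, EReal.coe_le_coe_iff, pile_y, pile_y, Nat.cast_le] at hit
      exact lt_of_le_of_ne hit hix
    have hsx : s < x := by
      have := h4.2.1
      rwa [← hyx, EReal.coe_lt_coe_iff, pile_y_lt] at this
    have hti : Touches (pile n i) σ :=
      IsSide.touches (Or.inr ⟨by tauto, hib, hit⟩) h1.1 h1.2.1
    refine Or.inr ⟨hsx, i, Finset.mem_filter.2 ⟨hiR, ?_, fun y hy =>
      not_mem_of_between h1 hti h3 (Finset.mem_insert_of_mem hy)⟩, hl⟩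
    by_contra hsi
    have hsi : s < i := lt_of_le_of_ne (not_lt.1 hsi) his.symm
    have hnb := not_mem_of_between h1 htx h3 hi
    rw [mem_between, min_eq_right hsx.le, max_eq_left hsx.le] at hnb
    have hil : (i : ℕ) < n - n / 2 := by
      by_contra h
      exact hnb ⟨hsi, hix', Or.inl (not_lt.1 h)⟩
    have hap := pile_apart hsi hil
    have h5 : (((pile n i).l : ℝ) : EReal) ≤ σ.left := by
      rcases hl with h | h
      · exact h.le
      · exact (EReal.coe_le_coe_iff.2 (pile n i).l_lt_r.le).trans h.le
    exact absurd (h5.trans_lt h4.2.2.1) (not_lt.2 (EReal.coe_le_coe_iff.2 hap.le))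
  · have hxi : x < i := by
      rw [← hyx, EReal.coe_le_coe_iff, pile_y, pile_y, Nat.cast_le] at hib
      exact lt_of_le_of_ne hib hix.symm
    exfalso
    have hr : σ.left ≤ ((pile n x).r : EReal) := h1.1.le.trans hrx
    rcases hl with h | h <;> rw [← h, EReal.coe_le_coe_iff] at hlx hr
    · exact pile_end_not_mem hxi (Or.inl rfl) hlx hr
    · exact pile_end_not_mem hxi (Or.inr rfl) hlx hr

/-- A created trapezoid met by `s` is determined by its left side, and also by its right side. The
two end-points of `x` account for two left and two right sides, and each visible segment for two
further left sides. The constant filter switches the last term off unless `s < x`. -/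
theorem ncard_created_le_visibleBelow {R : Finset (Fin n)} {x s : Fin n} (hs : s ∉ R)
    (hxs : x ≠ s) : (created R x s).ncard ≤ 4 + 2 * ((visibleBelow R s).filter fun _ => s < x).card := by
  classical
  let Q := (visibleBelow R s).filter fun _ => s < x
  let V : Finset EReal := {((pile n x).l : EReal), ((pile n x).r : EReal)}
  let P : Finset EReal := Q.image (fun i => ((pile n i).l : EReal)) ∪
    Q.image (fun i => ((pile n i).r : EReal))
  let A : Set Box := {σ | σ ∈ created R x s ∧ σ.left ∈ V ∪ P}
  let B : Set Box := {σ | σ ∈ created R x s ∧ σ.right ∈ V}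
  have hV : V.card ≤ 2 := Finset.card_le_two
  have hP : P.card ≤ 2 * Q.card := by
    refine (Finset.card_union_le _ _).trans ?_
    rw [two_mul]
    exact add_le_add Finset.card_image_le Finset.card_image_le
  have hA : A.ncard ≤ (V ∪ P).card := by
    rw [← Set.ncard_coe_finset]
    refine Set.ncard_le_ncard_of_injOn Box.left (fun σ h => h.2) ?_ (Finset.finite_toSet _)
    intro σ h τ h' e
    exact eq_of_left_eq (pile_nonIntersecting n) h.1.1 h'.1.1 h.1.2.2 h'.1.2.2 e
  have hB : B.ncard ≤ V.card := by
    rw [← Set.ncard_coe_finset]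
    refine Set.ncard_le_ncard_of_injOn Box.right (fun σ h => h.2) ?_ (Finset.finite_toSet _)
    intro σ h τ h' e
    exact eq_of_right_eq (pile_nonIntersecting n) h.1.1 h'.1.1 h.1.2.2 h'.1.2.2 e
  have hsub : created R x s ⊆ A ∪ B := by
    intro σ hσ
    rcases created_subset hs hxs hσ with (h | h | h | h) | ⟨hsx, i, hi, h | h⟩
    · exact Or.inl ⟨hσ, by simp [V, h]⟩
    · exact Or.inl ⟨hσ, by simp [V, h]⟩
    · exact Or.inr ⟨hσ, by simp [V, h]⟩
    · exact Or.inr ⟨hσ, by simp [V, h]⟩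
    · exact Or.inl ⟨hσ, Finset.mem_union_right _ (Finset.mem_union_left _
        (Finset.mem_image.2 ⟨i, Finset.mem_filter.2 ⟨hi, hsx⟩, h⟩))⟩
    · exact Or.inl ⟨hσ, Finset.mem_union_right _ (Finset.mem_union_right _
        (Finset.mem_image.2 ⟨i, Finset.mem_filter.2 ⟨hi, hsx⟩, h⟩))⟩
  have hfin := created_finite R x s
  have h1 := Set.ncard_le_ncard hsub ((hfin.subset fun _ h => h.1).union
    (hfin.subset fun _ h => h.1))
  have h2 := Set.ncard_union_le A B
  have h3 := Finset.card_union_le V P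
  have h4 : Q.card = ((visibleBelow R s).filter fun _ => s < x).card := rfl
  omega

/-- Among the visible segments below `s`, at most one belongs to the pile of `s`. -/
theorem card_visibleBelow_le (R : Finset (Fin n)) (s : Fin n) :
    (visibleBelow R s).card ≤ 1 + ((visibleBelow R s).filter fun i : Fin n =>
      (i : ℕ) < n - n / 2 ∧ n - n / 2 ≤ (s : ℕ)).card := by
  rw [← Finset.card_filter_add_card_filter_not (s := visibleBelow R s) fun i : Fin n =>
      (i : ℕ) < n - n / 2 ∧ n - n / 2 ≤ (s : ℕ), add_comm]
  gcongr
  rw [Finset.card_le_one]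
  -- The higher segment `j` separates `i` from `s`, unless `j` is lower and `s` upper.
  have key : ∀ i j : Fin n, i ∈ visibleBelow R s → j ∈ visibleBelow R s → i < j →
      ¬ ((j : ℕ) < n - n / 2 ∧ n - n / 2 ≤ (s : ℕ)) → False := by
    intro i j hi hj hij h
    obtain ⟨hi1, hi2, hi3⟩ := Finset.mem_filter.1 hi
    obtain ⟨hj1, hj2, hj3⟩ := Finset.mem_filter.1 hj
    refine hi3 j hj1 (mem_between.2 ?_)
    rw [min_eq_left hi2.le, max_eq_right hi2.le]
    refine ⟨hij, hj2, ?_⟩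
    by_contra h'
    push Not at h'
    exact h h'
  intro i hi j hj
  rw [Finset.mem_filter] at hi hj
  by_contra hij
  rcases Ne.lt_or_gt hij with h | h
  · exact key i j hi.1 hj.1 h hj.2
  · exact key j i hj.1 hi.1 h hi.2

/-- The number of conflicts of `s` created by the insertion of `x`: a constant, except when `x`
becomes the lowest upper segment, and none if some inserted segment separates `x` from `s`. -/
theorem ncard_created_le {R : Finset (Fin n)} {x s : Fin n} (hs : s ∉ R) (hxs : x ≠ s) :
    (created R x s).ncard ≤
      (if ∀ y ∈ between x s, y ∉ R then 6 else 0) +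
      (if n - n / 2 ≤ (s : ℕ) ∧ s < x ∧ ∀ y : Fin n, n - n / 2 ≤ (y : ℕ) → y < x → y ∉ R then
        2 * (R.filter fun i : Fin n => (i : ℕ) < n - n / 2).card else 0) := by
  classical
  rcases (created R x s).eq_empty_or_nonempty with h | ⟨σ, hσ⟩
  · rw [h, Set.ncard_empty]; exact Nat.zero_le _
  have htx := (isSide_of_new hσ.1 hσ.2.1).touches hσ.1.1 hσ.1.2.1
  have hblock : ∀ y ∈ between x s, y ∉ R := fun y hy hyR =>
    not_mem_of_between hσ.1 htx hσ.2.2 (Finset.mem_insert_of_mem hyR) hy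
  rw [if_pos hblock]
  -- At most one visible segment is not of the kind lower beneath upper, whence the constant 6 = 4 +
  -- 2 · 1.
  have h1 := ncard_created_le_visibleBelow hs hxs
  have h2 := card_visibleBelow_le R s
  rcases lt_or_ge s x with hsx | hsx
  swap
  · rw [Finset.filter_false_of_mem fun _ _ => not_lt.2 hsx, Finset.card_empty] at h1
    omega
  rw [Finset.filter_true_of_mem fun _ _ => hsx] at h1
  have h3 : ((visibleBelow R s).filter fun i : Fin n =>
      (i : ℕ) < n - n / 2 ∧ n - n / 2 ≤ (s : ℕ)).card ≤
      (R.filter fun i : Fin n => (i : ℕ) < n - n / 2).card := by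
    refine Finset.card_le_card fun j hj => ?_
    rw [Finset.mem_filter] at hj ⊢
    exact ⟨(Finset.mem_filter.1 hj.1).1, hj.2.1⟩
  rcases ((visibleBelow R s).filter fun i : Fin n =>
      (i : ℕ) < n - n / 2 ∧ n - n / 2 ≤ (s : ℕ)).eq_empty_or_nonempty with h4 | ⟨i, hi⟩
  · rw [h4, Finset.card_empty] at h2
    omega
  obtain ⟨hi, hil, hsu⟩ := Finset.mem_filter.1 hi
  obtain ⟨-, hi2, hi3⟩ := Finset.mem_filter.1 hi
  -- A visible lower `i` beneath an upper `s` forces `x` to be the lowest upper segment: an inserted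
  -- upper one below `s` would separate `i` from `s`, and one between `s` and `x` would separate `x`
  -- from `s`.
  rw [if_pos]
  · omega
  refine ⟨hsu, hsx, fun y hyu hyx hyR => ?_⟩
  rcases lt_trichotomy y s with h | rfl | h
  · refine hi3 y hyR (mem_between.2 ?_)
    rw [min_eq_left hi2.le, max_eq_right hi2.le]
    exact ⟨Fin.lt_def.2 (hil.trans_le hyu), h, Or.inl hyu⟩
  · exact hs hyR
  · refine hblock y (mem_between.2 ?_) hyR
    rw [min_eq_right hsx.le, max_eq_left hsx.le]
    exact ⟨h, hyx, Or.inl hyu⟩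

/-! ### Lower bounds for the conflicts created by one insertion. -/

theorem pile_end_not_mem_lower {b j : Fin n} (hb : (b : ℕ) < n - n / 2) (hj : j ≠ b) {x : ℝ}
    (hx : (pile n j).IsEndAbscissa x) (h1 : (pile n b).l ≤ x) (h2 : x ≤ (pile n b).r) :
    False := by
  rcases hj.lt_or_gt with h | h
  · have h3 := pile_apart h hb
    have h4 := (pile n j).l_lt_r
    rcases hx with rfl | rfl <;> linarith
  · exact pile_end_not_mem h hx h1 h2

/-- The abscissa of the midpoint of the lower segment `b`. -/
noncomputable def mid (b : Fin n) : ℝ := 2 * (b : ℝ) + 1 / 2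

theorem mid_mem {b : Fin n} (hb : (b : ℕ) < n - n / 2) :
    (pile n b).l < mid b ∧ mid b < (pile n b).r := by
  rw [(pile_of_lower hb).1, (pile_of_lower hb).2, mid]
  constructor <;> linarith

theorem mid_mem_of_le {b i : Fin n} (hb : (b : ℕ) < n - n / 2)
    (hi : n - n / 2 ≤ (i : ℕ) ∨ i = b) : (pile n i).l < mid b ∧ mid b < (pile n i).r := by
  have h := mid_mem hb
  rcases hi with hi | rfl
  · have h1 := pile_wider (Fin.lt_def.2 (hb.trans_le hi)) hi
    exact ⟨h1.1.trans h.1, h.2.trans h1.2⟩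
  · exact h

theorem eq_of_mid_mem {b i : Fin n} (hb : (b : ℕ) < n - n / 2) (hi : (i : ℕ) < n - n / 2)
    (h1 : (pile n i).l ≤ mid b) (h2 : mid b ≤ (pile n i).r) : i = b := by
  have h := mid_mem hb
  rcases lt_trichotomy i b with h3 | h3 | h3
  · have := pile_apart h3 hb; linarith
  · exact h3
  · have := pile_apart h3 hi; linarith

/-- A point of an uninserted segment above the midpoint of a lower segment lies in a trapezoid. -/
theorem exists_trapezoid_mid {b s : Fin n} {R : Finset (Fin n)} (hb : (b : ℕ) < n - n / 2)
    (hs : s ∉ R) :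
    ∃ σ ∈ trapezoids (pile n) R, (mid b, (pile n s).y) ∈ σ.region := by
  have h := mid_mem hb
  refine exists_trapezoid (pile n) R _ (fun i hi hp => ?_) fun i hi => ?_
  · have h1 := hp.2.2
    simp only [pile_y, Nat.cast_inj] at h1
    exact hs (Fin.ext h1 ▸ hi)
  · rcases eq_or_ne i b with rfl | hib
    · exact ⟨h.1.ne', h.2.ne⟩
    · exact ⟨fun h1 => pile_end_not_mem_lower hb hib (Or.inl h1) h.1.le h.2.le,
        fun h1 => pile_end_not_mem_lower hb hib (Or.inr h1) h.1.le h.2.le⟩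

theorem conflicts_of_mid {b s : Fin n} {σ : Box} (hb : (b : ℕ) < n - n / 2)
    (hs : n - n / 2 ≤ (s : ℕ) ∨ s = b) (hp : (mid b, (pile n s).y) ∈ σ.region) :
    Conflicts (pile n s) σ :=
  ⟨_, ⟨(mid_mem_of_le hb hs).1.le, (mid_mem_of_le hb hs).2.le, rfl⟩, hp⟩

/-- A segment carrying a horizontal side of a box above `mid b` is `b` or an upper one. -/
theorem spanning {b i : Fin n} {σ : Box} (hb : (b : ℕ) < n - n / 2)
    (h1 : σ.left < (mid b : EReal)) (h2 : (mid b : EReal) < σ.right)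
    (h3 : ((pile n i).l : EReal) ≤ σ.left) (h4 : σ.right ≤ ((pile n i).r : EReal)) :
    n - n / 2 ≤ (i : ℕ) ∨ i = b := by
  by_contra! h
  exact h.2 (eq_of_mid_mem hb h.1 (EReal.coe_le_coe_iff.1 (h3.trans h1.le))
    (EReal.coe_le_coe_iff.1 (h2.le.trans h4)))

/-- The insertion of a lower segment creates a conflict with each lower segment not separated
from it. -/
theorem created_nonempty {R : Finset (Fin n)} {x s : Fin n} (hx : (x : ℕ) < n - n / 2)
    (hs : (s : ℕ) < n - n / 2) (hxs : x ≠ s) (hxR : x ∉ R) (hsR : s ∉ R)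
    (hb : ∀ y ∈ between x s, y ∉ R) : (created R x s).Nonempty := by
  have hs' : s ∉ insert x R := by simp [hsR, hxs.symm]
  obtain ⟨σ, hσ, hp⟩ := exists_trapezoid_mid (b := s) hs hs'
  refine ⟨σ, hσ, fun hR => ?_, conflicts_of_mid hs (Or.inr rfl) hp⟩
  obtain ⟨hp1, hp2, hp3, hp4⟩ := hp
  simp only at hp1 hp2 hp3 hp4
  -- Every inserted end-point lies to one side of both `x` and `s`: the only candidates between them
  -- are lower segments in `between x s`.
  have hends : ∀ i ∈ R, ∀ v, (pile n i).IsEndAbscissa v →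
      (v < (pile n x).l ∧ v < (pile n s).l) ∨ ((pile n x).r < v ∧ (pile n s).r < v) := by
    intro i hi v hv
    have hix : i ≠ x := fun h => hxR (h ▸ hi)
    have his : i ≠ s := fun h => hsR (h ▸ hi)
    have hi' := (pile n i).l_lt_r
    rcases lt_or_ge (i : ℕ) (n - n / 2) with hil | hiu
    · have hnb := fun h => hb i h hi
      rw [mem_between] at hnb
      rcases hix.lt_or_gt with h1 | h1 <;> rcases his.lt_or_gt with h2 | h2
      · have h3 := pile_apart h1 hx
        have h4 := pile_apart h2 hs
        left; rcases hv with rfl | rfl <;> constructor <;> linarith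
      · exact absurd ⟨min_lt_of_right_lt h2, lt_max_of_lt_left h1, Or.inr (by
          rcases max_choice x s with h | h <;> rw [h] <;> assumption)⟩ hnb
      · exact absurd ⟨min_lt_of_left_lt h1, lt_max_of_lt_right h2, Or.inr (by
          rcases max_choice x s with h | h <;> rw [h] <;> assumption)⟩ hnb
      · have h3 := pile_apart h1 hil
        have h4 := pile_apart h2 hil
        right; rcases hv with rfl | rfl <;> constructor <;> linarith
    · have h1 := pile_wider (Fin.lt_def.2 (hx.trans_le hiu)) hiu
      have h2 := pile_wider (Fin.lt_def.2 (hs.trans_le hiu)) hiu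
      rcases hv with rfl | rfl
      · exact Or.inl ⟨h1.1, h2.1⟩
      · exact Or.inr ⟨h1.2, h2.2⟩
  have hms := mid_mem hs
  -- Were `σ` a trapezoid already before the insertion, it would be unbounded below, bounded above
  -- only by an upper segment, and wide enough to reach `x`; so `x` would cut it.
  refine hσ.2.2.2.2.2.2 x (Finset.mem_insert_self _ _) ((conflicts_iff hσ.1).2 ⟨?_, ?_, ?_, ?_⟩)
  · rcases hR.2.2.2.1 with h | ⟨i, hi, h, h3, h4⟩
    · rw [h]; exact EReal.bot_lt_coe _
    · exfalso
      rw [← h, EReal.coe_lt_coe_iff, pile_y_lt] at hp3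
      rcases spanning hs hp1 hp2 h3 h4 with h5 | h5
      · exact absurd (Fin.lt_def.1 hp3) (by omega)
      · exact hsR (h5 ▸ hi)
  · rcases hR.2.2.1 with h | ⟨i, hi, h, h3, h4⟩
    · rw [h]; exact EReal.coe_lt_top _
    · rcases spanning hs hp1 hp2 h3 h4 with h5 | h5
      · rw [← h, EReal.coe_lt_coe_iff, pile_y_lt]
        exact Fin.lt_def.2 (hx.trans_le h5)
      · exact absurd hi (h5 ▸ hsR)
  · by_contra! hle
    rcases hR.2.2.2.2.1 with h | ⟨i, hi, h, -⟩
    · rw [h] at hle; simp at hle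
    obtain ⟨v, hv, hve⟩ : ∃ v : ℝ, (pile n i).IsEndAbscissa v ∧ (v : EReal) = σ.left := by
      rcases h with h | h
      · exact ⟨_, Or.inl rfl, h⟩
      · exact ⟨_, Or.inr rfl, h⟩
    rw [← hve, EReal.coe_le_coe_iff] at hle
    rw [← hve, EReal.coe_lt_coe_iff] at hp1
    rcases hends i hi v hv with h1 | h1
    · linarith [(pile n x).l_lt_r]
    · linarith [(pile n x).l_lt_r]
  · by_contra! hle
    rcases hR.2.2.2.2.2.1 with h | ⟨i, hi, h, -⟩
    · rw [h] at hle; simp at hle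
    obtain ⟨v, hv, hve⟩ : ∃ v : ℝ, (pile n i).IsEndAbscissa v ∧ (v : EReal) = σ.right := by
      rcases h with h | h
      · exact ⟨_, Or.inl rfl, h⟩
      · exact ⟨_, Or.inr rfl, h⟩
    rw [← hve, EReal.coe_le_coe_iff] at hle
    rw [← hve, EReal.coe_lt_coe_iff] at hp2
    rcases hends i hi v hv with h1 | h1
    · linarith [(pile n x).l_lt_r]
    · linarith [(pile n x).l_lt_r]

/-- When `x` becomes the lowest upper segment, each upper segment below `x` gets a conflict with
the trapezoid above each inserted lower segment. -/
theorem card_le_ncard_created {R D : Finset (Fin n)} {x s : Fin n} (hDR : D ⊆ R)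
    (hD : ∀ b ∈ D, (b : ℕ) < n - n / 2) (hs : n - n / 2 ≤ (s : ℕ)) (hsx : s < x)
    (hR : ∀ i ∈ R, n - n / 2 ≤ (i : ℕ) → x < i) : D.card ≤ (created R x s).ncard := by
  have hsR : s ∉ R := fun h => lt_asymm hsx (hR s h hs)
  have hs' : s ∉ insert x R := by simp [hsR, hsx.ne]
  have : Nonempty Box := ⟨⟨⊥, ⊤, ⊥, ⊤⟩⟩
  -- `f b` is the trapezoid met at the height of `s` above the midpoint of `b`. It is new, because
  -- before the insertion the ceiling there was above `x`.
  choose! f hf hfp using fun b hb => exists_trapezoid_mid (b := b) (hD b hb) hs'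
  rw [← Set.ncard_coe_finset]
  refine Set.ncard_le_ncard_of_injOn f (fun b hb => ?_) ?_ (created_finite R x s)
  · have hbl := hD b hb
    refine ⟨hf b hb, fun hR' => ?_, conflicts_of_mid hbl (Or.inl hs) (hfp b hb)⟩
    obtain ⟨h1, h2, h3, h4⟩ := hfp b hb
    have hxm := mid_mem_of_le hbl (Or.inl (hs.trans hsx.le))
    refine (hf b hb).2.2.2.2.2.2 x (Finset.mem_insert_self _ _)
      ((conflicts_iff (hf b hb).1).2 ⟨?_, ?_, ?_, ?_⟩)
    · exact h3.trans (EReal.coe_lt_coe_iff.2 (pile_y_lt.2 hsx))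
    · rcases hR'.2.2.1 with h | ⟨i, hi, h, h5, h6⟩
      · rw [h]; exact EReal.coe_lt_top _
      · rw [← h, EReal.coe_lt_coe_iff, pile_y_lt] at h4
        rw [← h, EReal.coe_lt_coe_iff, pile_y_lt]
        exact hR i hi (hs.trans (Fin.le_def.1 h4.le))
    · exact h1.trans (EReal.coe_lt_coe_iff.2 hxm.2)
    · exact (EReal.coe_lt_coe_iff.2 hxm.1).trans h2
  -- The floor of `f b'` is finite because `b'` lies beneath it. It is carried by a lower segment
  -- spanning the chosen midpoint, so the floor identifies the segment.
  · have key : ∀ b ∈ D, ∀ b' ∈ D, f b = f b' → b < b' → False := by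
      intro b hb b' hb' e hlt
      obtain ⟨h1, h2, -, -⟩ := hfp b hb
      obtain ⟨h1', h2', h3, h4⟩ := hfp b' hb'
      rw [e] at h1 h2
      have hbs : b' < s := Fin.lt_def.2 ((hD b' hb').trans_le hs)
      have hm := mid_mem (hD b' hb')
      have hbot : ((pile n b').y : EReal) ≤ (f b').bot := by
        by_contra! h
        exact (hf b' hb').2.2.2.2.2.2 b' (Finset.mem_insert_of_mem (hDR hb'))
          ((conflicts_iff (hf b' hb').1).2
            ⟨h, (EReal.coe_lt_coe_iff.2 (pile_y_lt.2 hbs)).trans h4,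
              h1'.trans (EReal.coe_lt_coe_iff.2 hm.2), (EReal.coe_lt_coe_iff.2 hm.1).trans h2'⟩)
      rcases (hf b' hb').2.2.2.1 with h | ⟨i, hi, h, h5, h6⟩
      · rw [h] at hbot; simp at hbot
      · rw [← h, EReal.coe_lt_coe_iff, pile_y_lt] at h3
        have hil : ¬ n - n / 2 ≤ (i : ℕ) := by
          intro hiu
          rcases Finset.mem_insert.1 hi with rfl | hi
          · exact lt_asymm h3 hsx
          · exact lt_asymm h3 (hsx.trans (hR i hi hiu))
        have e1 := (spanning (hD b hb) h1 h2 h5 h6).resolve_left hil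
        have e2 := (spanning (hD b' hb') h1' h2' h5 h6).resolve_left hil
        exact hlt.ne (e1.symm.trans e2)
    intro b hb b' hb' e
    by_contra hne
    rcases Ne.lt_or_gt hne with h | h
    · exact key b hb b' hb' e h
    · exact key b' hb' b hb e.symm h

/-! ### The work as a sum over pairs of segments -/

theorem mem_inserted {π : Equiv.Perm (Fin n)} {k : ℕ} {i : Fin n} :
    i ∈ inserted π k ↔ (π.symm i : ℕ) < k := by
  simp only [inserted, Finset.mem_map_equiv, Finset.mem_filter, Finset.mem_univ, true_and]

theorem inserted_succ (π : Equiv.Perm (Fin n)) (k : Fin n) :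
    inserted π (k + 1) = insert (π k) (inserted π k) := by
  ext i
  rw [mem_inserted, Finset.mem_insert, mem_inserted, Nat.lt_succ_iff_lt_or_eq, or_comm,
    ← Fin.ext_iff, Equiv.symm_apply_eq]

/-- A segment still waiting after the insertion was waiting before it, so an edge is new exactly
when its trapezoid is new; the fibre over `s` is `created R x s`. -/
theorem ncard_new_edges (R : Finset (Fin n)) (x : Fin n) :
    (conflictGraph (pile n) (insert x R) \ conflictGraph (pile n) R).ncard =
      ∑ s ∈ Finset.univ.filter fun s => s ∉ insert x R, (created R x s).ncard := by
  classical
  have hfin := (conflictGraph_finite (pile n) (insert x R)).sdiff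
    (t := conflictGraph (pile n) R)
  rw [Set.ncard_eq_toFinset_card _ hfin, Finset.card_eq_sum_card_fiberwise (f := Prod.snd)
    (t := Finset.univ.filter fun s => s ∉ insert x R)]
  · refine Finset.sum_congr rfl fun s hs => ?_
    have hs' : s ∉ insert x R := (Finset.mem_filter.1 hs).2
    have hsR : s ∉ R := fun h => hs' (Finset.mem_insert_of_mem h)
    rw [← Set.ncard_coe_finset, ← Set.ncard_image_of_injective (f := fun σ : Box => (σ, s)) _
      (Prod.mk_left_injective s)]
    congr 1
    ext ⟨σ, s'⟩
    simp only [Finset.coe_filter, Set.Finite.mem_toFinset, Set.mem_sdiff, conflictGraph,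
      Set.mem_ofPred_eq, created, Set.mem_image, Prod.mk.injEq]
    constructor
    · rintro ⟨⟨⟨h1, h2, h3⟩, h4⟩, rfl⟩
      exact ⟨σ, ⟨h1, fun h => h4 ⟨h, hsR, h3⟩, h3⟩, rfl, rfl⟩
    · rintro ⟨τ, ⟨h1, h2, h3⟩, rfl, rfl⟩
      exact ⟨⟨⟨h1, hs', h3⟩, fun h => h2 h.1⟩, rfl⟩
  · intro e he
    simp only [Finset.mem_coe, Set.Finite.mem_toFinset] at he
    simpa using he.1.2.1

/-- The segments inserted before `x`. -/
def before (π : Equiv.Perm (Fin n)) (x : Fin n) : Finset (Fin n) := inserted π (π.symm x)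

theorem mem_before {π : Equiv.Perm (Fin n)} {x i : Fin n} :
    i ∈ before π x ↔ π.symm i < π.symm x := by
  rw [before, mem_inserted, Fin.lt_def]

theorem work_pile (π : Equiv.Perm (Fin n)) :
    work (pile n) π = ∑ x, ∑ s ∈ Finset.univ.filter fun s => π.symm x < π.symm s,
      (created (before π x) x s).ncard := by
  rw [work, Finset.sum_range, ← Equiv.sum_comp π fun x =>
    ∑ s ∈ Finset.univ.filter fun s => π.symm x < π.symm s, (created (before π x) x s).ncard]
  refine Finset.sum_congr rfl fun k _ => ?_
  rw [inserted_succ, ncard_new_edges]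
  have h : before π (π k) = inserted π k := by rw [before, Equiv.symm_apply_apply]
  rw [h]
  refine Finset.sum_congr ?_ fun s _ => rfl
  ext s
  rw [Finset.mem_filter, Finset.mem_filter, ← inserted_succ, mem_inserted,
    Equiv.symm_apply_apply, Fin.lt_def]
  simp only [Finset.mem_univ, true_and]
  omega

/-! ### Counting permutations -/

theorem card_filter_mul_right (σ : Equiv.Perm (Fin n)) (P : Equiv.Perm (Fin n) → Prop)
    [DecidablePred P] :
    (Finset.univ.filter fun p => P (p * σ)).card = (Finset.univ.filter P).card := by
  refine Finset.card_bij' (fun p _ => p * σ) (fun p _ => p * σ⁻¹) ?_ ?_ ?_ ?_ <;> simp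

/-- The exchangeability principle behind the probability bounds: equally likely, mutually exclusive
events have probability at most one over their number. -/
theorem card_mul_card_le_factorial {ι : Type*} (I : Finset ι)
    (E : ι → Finset (Equiv.Perm (Fin n))) (c : ℕ) (hc : ∀ i ∈ I, (E i).card = c)
    (hE : ∀ i ∈ I, ∀ j ∈ I, ∀ p, p ∈ E i → p ∈ E j → i = j) : c * I.card ≤ n.factorial := by
  classical
  have h1 : (I.biUnion E).card = ∑ i ∈ I, (E i).card :=
    Finset.card_biUnion fun i hi j hj hij => Finset.disjoint_left.2 fun p h1 h2 =>
      hij (hE i hi j hj p h1 h2)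
  rw [Finset.sum_congr rfl hc, Finset.sum_const, smul_eq_mul, mul_comm] at h1
  rw [← h1]
  exact (Finset.card_le_univ _).trans (by rw [Fintype.card_perm, Fintype.card_fin])

/-- A given element of `A` comes first among `A` with probability at most `1 / |A|`. -/
theorem card_first_mul_le {A : Finset (Fin n)} {x : Fin n} (hx : x ∈ A) :
    (Finset.univ.filter fun p : Equiv.Perm (Fin n) => ∀ y ∈ A, p x ≤ p y).card * A.card ≤
      n.factorial := by
  refine card_mul_card_le_factorial A
    (fun z => Finset.univ.filter fun p : Equiv.Perm (Fin n) => ∀ y ∈ A, p z ≤ p y) _ ?_ ?_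
  · intro z hz
    rw [← card_filter_mul_right (Equiv.swap x z)]
    congr 1
    ext p
    simp only [Finset.mem_filter, Finset.mem_univ, true_and, Equiv.Perm.mul_apply,
      Equiv.swap_apply_right]
    have hmem : ∀ y ∈ A, Equiv.swap x z y ∈ A := by
      intro y hy
      rw [Equiv.swap_apply_def]
      split_ifs <;> assumption
    refine ⟨fun h y hy => ?_, fun h y hy => h _ (hmem y hy)⟩
    have := h _ (hmem y hy)
    rwa [Equiv.swap_apply_self] at this
  · intro i hi j hj p h1 h2
    simp only [Finset.mem_filter, Finset.mem_univ, true_and] at h1 h2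
    exact p.injective (le_antisymm (h1 j hj) (h2 i hi))

/-- Double transitivity on `A`, which makes the events for different ordered pairs equally likely.
-/
theorem exists_perm_map_pair {A : Finset (Fin n)} {a b a' b' : Fin n} (ha : a ∈ A) (hb : b ∈ A)
    (ha' : a' ∈ A) (hb' : b' ∈ A) (h : a ≠ b) (h' : a' ≠ b') :
    ∃ σ : Equiv.Perm (Fin n), σ a' = a ∧ σ b' = b ∧ ∀ y, σ y ∈ A ↔ y ∈ A := by
  have hswap : ∀ u ∈ A, ∀ v ∈ A, ∀ y, Equiv.swap u v y ∈ A ↔ y ∈ A := by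
    intro u hu v hv y
    rw [Equiv.swap_apply_def]
    split_ifs with h1 h2
    · subst h1; exact ⟨fun _ => hu, fun _ => hv⟩
    · subst h2; exact ⟨fun _ => hv, fun _ => hu⟩
    · rfl
  have hc : Equiv.swap a a' b' ∈ A := (hswap a ha a' ha' b').2 hb'
  refine ⟨Equiv.swap b (Equiv.swap a a' b') * Equiv.swap a a', ?_, ?_, fun y => ?_⟩
  · rw [Equiv.Perm.mul_apply, Equiv.swap_apply_right]
    refine Equiv.swap_apply_of_ne_of_ne h fun e => h' ?_
    rw [eq_comm, Equiv.swap_apply_eq_iff, Equiv.swap_apply_left] at e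
    exact e.symm
  · rw [Equiv.Perm.mul_apply, Equiv.swap_apply_right]
  · rw [Equiv.Perm.mul_apply, hswap b hb _ hc, hswap a ha a' ha']

/-- `b` and `x` come first and second among `L ∪ {b}` with probability at most
`1 / (|L| (|L| + 1))`. -/
theorem card_first_second_mul_le {L : Finset (Fin n)} {b x : Fin n} (hb : b ∉ L) (hx : x ∈ L) :
    (Finset.univ.filter fun p : Equiv.Perm (Fin n) =>
      p b < p x ∧ ∀ y ∈ L, p x ≤ p y).card * (L.card * (L.card + 1)) ≤ n.factorial := by
  classical
  let A := insert b L
  have hA : A.offDiag.card = L.card * (L.card + 1) := by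
    rw [Finset.offDiag_card, Finset.card_insert_of_notMem hb]
    rw [Nat.sub_eq_iff_eq_add (Nat.le_mul_self _)]
    ring
  have hbA : b ∈ A := Finset.mem_insert_self _ _
  have hxA : x ∈ A := Finset.mem_insert_of_mem hx
  have hbx : b ≠ x := fun h => hb (h ▸ hx)
  rw [← hA]
  -- The competing events say which ordered pair of `A` comes first and second.
  refine card_mul_card_le_factorial A.offDiag (fun q => Finset.univ.filter
    fun p : Equiv.Perm (Fin n) => p q.1 < p q.2 ∧ ∀ y ∈ A, y ≠ q.1 → p q.2 ≤ p y) _ ?_ ?_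
  · rintro ⟨b', x'⟩ hq
    obtain ⟨hb', hx', hne⟩ := Finset.mem_offDiag.1 hq
    obtain ⟨σ, h1, h2, h3⟩ := exists_perm_map_pair hbA hxA hb' hx' hbx hne
    rw [← card_filter_mul_right σ]
    congr 1
    ext p
    simp only [Finset.mem_filter, Finset.mem_univ, true_and, Equiv.Perm.mul_apply, h1, h2]
    refine and_congr_right fun _ => ⟨fun h y hy => ?_, fun h y hy hyb => ?_⟩
    · have := h (σ.symm y) ((h3 _).1 (by
        rw [Equiv.apply_symm_apply]; exact Finset.mem_insert_of_mem hy)) (fun e => by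
        rw [Equiv.symm_apply_eq, h1] at e
        exact hb (e ▸ hy))
      rwa [Equiv.apply_symm_apply] at this
    · refine h _ (Finset.mem_of_mem_insert_of_ne ((h3 y).2 hy) fun e => hyb ?_)
      exact σ.injective (e.trans h1.symm)
  · rintro ⟨b1, x1⟩ hq1 ⟨b2, x2⟩ hq2 p h1 h2
    obtain ⟨hb1, hx1, hne1⟩ := Finset.mem_offDiag.1 hq1
    obtain ⟨hb2, hx2, hne2⟩ := Finset.mem_offDiag.1 hq2
    simp only [Finset.mem_filter, Finset.mem_univ, true_and] at h1 h2 hb1 hb2 hx1 hx2 hne1 hne2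
    have hbb : b1 = b2 := by
      by_contra hne
      have h3 := h1.2 b2 hb2 (Ne.symm hne)
      have h4 := h2.2 b1 hb1 hne
      exact absurd (h1.1.trans_le h3) (not_lt.2 (h2.1.le.trans h4))
    subst hbb
    have hxx : x1 = x2 :=
      p.injective (le_antisymm (h1.2 x2 hx2 hne2.symm) (h2.2 x1 hx1 hne1.symm))
    rw [hxx]

/-! ### Permutations with a prescribed prefix. -/

/-- The permutations whose first `k` values lie in prescribed sets. -/
def prefixIn (A : ℕ → Finset (Fin n)) (k : ℕ) : Finset (Equiv.Perm (Fin n)) :=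
  Finset.univ.filter fun π => ∀ i : Fin n, (i : ℕ) < k → π i ∈ A i

theorem mem_prefixIn {A : ℕ → Finset (Fin n)} {k : ℕ} {π : Equiv.Perm (Fin n)} :
    π ∈ prefixIn A k ↔ ∀ i : Fin n, (i : ℕ) < k → π i ∈ A i := by
  simp [prefixIn]

theorem card_inserted_le (π : Equiv.Perm (Fin n)) (k : ℕ) : (inserted π k).card ≤ k := by
  rw [inserted, Finset.card_map, ← Finset.card_map Fin.valEmbedding]
  conv_rhs => rw [← Finset.card_range k]
  refine Finset.card_le_card fun i hi => ?_
  obtain ⟨j, hj, rfl⟩ := Finset.mem_map.1 hi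
  exact Finset.mem_range.2 (Finset.mem_filter.1 hj).2

/-- Given a good prefix of length `k` and an unused value `a` in `A k`, exchange `a` with the value
at place `k`. The result extends the good prefix, and remembering the displaced value, one of `n`,
makes the map injective. -/
theorem card_prefixIn_mul_le (A : ℕ → Finset (Fin n)) {k : ℕ} (hk : k < n) :
    (prefixIn A k).card * ((A k).card - k) ≤ (prefixIn A (k + 1)).card * n := by
  classical
  have h1 : (prefixIn A k).card * ((A k).card - k) ≤
      ((prefixIn A k).sigma fun π => A k \ inserted π k).card := by
    rw [Finset.card_sigma, ← smul_eq_mul, ← Finset.sum_const]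
    refine Finset.sum_le_sum fun π _ => ?_
    exact (Nat.sub_le_sub_left (card_inserted_le π k) _).trans (Finset.le_card_sdiff _ _)
  refine h1.trans ?_
  have h2 : (prefixIn A (k + 1)).card * n =
      (prefixIn A (k + 1) ×ˢ (Finset.univ : Finset (Fin n))).card := by
    rw [Finset.card_product, Finset.card_univ, Fintype.card_fin]
  rw [h2]
  let K : Fin n := ⟨k, hk⟩
  refine Finset.card_le_card_of_injOn
    (fun q => (Equiv.swap (q.1 K) q.2 * q.1, q.1 K)) ?_ ?_
  · rintro ⟨π, a⟩ hq
    simp only [Finset.coe_sigma, Set.mem_sigma_iff, Finset.mem_coe, Finset.mem_sdiff,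
      mem_inserted, mem_prefixIn] at hq
    obtain ⟨hπ, ha, hak⟩ := hq
    simp only [Finset.mem_coe, Finset.mem_product, Finset.mem_univ, and_true, mem_prefixIn,
      Equiv.Perm.mul_apply]
    intro i hi
    rcases Nat.lt_succ_iff_lt_or_eq.1 hi with hi | hi
    · rw [Equiv.swap_apply_of_ne_of_ne]
      · exact hπ i hi
      · exact fun e => hi.ne (Fin.ext_iff.1 (π.injective e))
      · rintro rfl
        rw [Equiv.symm_apply_apply] at hak
        exact hak hi
    · have : i = K := Fin.ext hi
      rw [this, Equiv.swap_apply_left]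
      exact ha
  · rintro ⟨π, a⟩ _ ⟨π', a'⟩ _ e
    simp only [Prod.mk.injEq] at e
    obtain ⟨e1, e2⟩ := e
    have e3 : a = a' := by
      have := congrArg (fun p : Equiv.Perm (Fin n) => p K) e1
      simpa [Equiv.Perm.mul_apply] using this
    rw [e2, e3] at e1
    have e4 := mul_left_cancel e1
    rw [e3, e4]

theorem factorial_mul_prod_le_card_prefixIn (A : ℕ → Finset (Fin n)) (α : ℕ → ℝ)
    (hα : ∀ i, 0 ≤ α i) {k : ℕ} (hk : k ≤ n)
    (hA : ∀ i < k, α i * n ≤ ((A i).card - i : ℕ)) :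
    n.factorial * ∏ i ∈ Finset.range k, α i ≤ ((prefixIn A k).card : ℝ) := by
  induction k with
  | zero =>
    have : prefixIn A 0 = Finset.univ := by ext; simp [mem_prefixIn]
    rw [this, Finset.card_univ, Fintype.card_perm, Fintype.card_fin]
    simp
  | succ k ih =>
    have h1 := ih (by omega) fun i hi => hA i (by omega)
    have h2 : ((prefixIn A k).card : ℝ) * ((A k).card - k : ℕ) ≤
        ((prefixIn A (k + 1)).card : ℝ) * n := by
      exact_mod_cast card_prefixIn_mul_le A (show k < n by omega)
    have hn : (0 : ℝ) < n := by exact_mod_cast (show 0 < n by omega)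
    rw [Finset.prod_range_succ, ← mul_assoc]
    refine le_of_mul_le_mul_right ?_ hn
    calc n.factorial * (∏ i ∈ Finset.range k, α i) * α k * n
        = (n.factorial * (∏ i ∈ Finset.range k, α i)) * (α k * n) := by ring
      _ ≤ (prefixIn A k).card * ((A k).card - k : ℕ) := by
          refine mul_le_mul h1 (hA k (by omega)) ?_ (Nat.cast_nonneg _)
          exact mul_nonneg (hα k) hn.le
      _ ≤ _ := h2

/-! ### Depth in binary search trees. -/

/-- Few elements of a finite set `A` have small depth in the search tree of `A` for the insertion
order `f`. -/
theorem card_depth_lt {α : Type*} [LinearOrder α] (f : α → ℕ) (hf : Function.Injective f)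
    (d : ℕ) (A : Finset α) :
    (A.filter fun s => (A.filter fun x => f x < f s ∧
      ∀ y ∈ A, min x s < y → y < max x s → f x ≤ f y).card < d).card < 2 ^ d := by
  induction d generalizing A with
  | zero => simp
  | succ d ih =>
    rcases A.eq_empty_or_nonempty with rfl | hA
    · simp
    obtain ⟨c, hc, hmin⟩ := A.exists_min_image f hA
    let depth : Finset α → α → ℕ := fun A s => (A.filter fun x => f x < f s ∧
      ∀ y ∈ A, min x s < y → y < max x s → f x ≤ f y).card
    let Lo := A.filter (· < c)
    let Hi := A.filter (c < ·)
    -- The earliest element `c` is the root. Passing from one of its subtrees to the whole tree adds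
    -- the ancestor `c` to every element.
    have key : ∀ B : Finset α, B ⊆ A → c ∉ B →
        (∀ s ∈ B, ∀ x ∈ B, ∀ y ∈ A, min x s < y → y < max x s → y ∈ B) →
        ∀ s ∈ B, depth B s + 1 ≤ depth A s := by
      intro B hBA hcB hB s hs
      rw [← Finset.card_insert_of_notMem (s := B.filter _) (a := c)
        fun h => hcB (Finset.mem_filter.1 h).1]
      refine Finset.card_le_card fun x hx => ?_
      rcases Finset.mem_insert.1 hx with rfl | hx
      · refine Finset.mem_filter.2 ⟨hc, lt_of_le_of_ne (hmin s (hBA hs)) fun e => ?_,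
          fun y hy _ _ => hmin y hy⟩
        exact hcB (hf e ▸ hs)
      · obtain ⟨hx1, hx2, hx3⟩ := Finset.mem_filter.1 hx
        exact Finset.mem_filter.2 ⟨hBA hx1, hx2, fun y hy h1 h2 =>
          hx3 y (hB s hs x hx1 y hy h1 h2) h1 h2⟩
    have hsub : A.filter (fun s => depth A s < d + 1) ⊆
        insert c (Lo.filter (fun s => depth Lo s < d) ∪ Hi.filter fun s => depth Hi s < d) := by
      intro s hs
      obtain ⟨hsA, hsd⟩ := Finset.mem_filter.1 hs
      rcases lt_trichotomy s c with h | h | h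
      · have hsL : s ∈ Lo := Finset.mem_filter.2 ⟨hsA, h⟩
        have := key Lo (Finset.filter_subset _ _) (by simp [Lo]) (fun s hs x hx y hy _ h2 =>
          Finset.mem_filter.2 ⟨hy, h2.trans
            (max_lt (Finset.mem_filter.1 hx).2 (Finset.mem_filter.1 hs).2)⟩) s hsL
        exact Finset.mem_insert_of_mem (Finset.mem_union_left _
          (Finset.mem_filter.2 ⟨hsL, by omega⟩))
      · rw [h]; exact Finset.mem_insert_self _ _
      · have hsH : s ∈ Hi := Finset.mem_filter.2 ⟨hsA, h⟩
        have := key Hi (Finset.filter_subset _ _) (by simp [Hi]) (fun s hs x hx y hy h1 _ =>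
          Finset.mem_filter.2 ⟨hy,
            (lt_min (Finset.mem_filter.1 hx).2 (Finset.mem_filter.1 hs).2).trans h1⟩) s hsH
        exact Finset.mem_insert_of_mem (Finset.mem_union_right _
          (Finset.mem_filter.2 ⟨hsH, by omega⟩))
    have h1 := Finset.card_le_card hsub
    have h2 := Finset.card_insert_le c
      (Lo.filter (fun s => depth Lo s < d) ∪ Hi.filter fun s => depth Hi s < d)
    have h3 := Finset.card_union_le (Lo.filter fun s => depth Lo s < d)
      (Hi.filter fun s => depth Hi s < d)
    have h4 := ih Lo
    have h5 := ih Hi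
    have h6 : 2 ^ (d + 1) = 2 ^ d + 2 ^ d := by ring
    change (A.filter fun s => depth A s < d + 1).card < _
    change (Lo.filter fun s => depth Lo s < d).card < _ at h4
    change (Hi.filter fun s => depth Hi s < d).card < _ at h5
    omega

/-! ### Bounds on the work -/

/-- The lower pile. -/
def lowers (n : ℕ) : Finset (Fin n) := Finset.univ.filter fun i => (i : ℕ) < n - n / 2

theorem mem_lowers {i : Fin n} : i ∈ lowers n ↔ (i : ℕ) < n - n / 2 := by simp [lowers]

theorem card_lowers (n : ℕ) : (lowers n).card = n - n / 2 := by
  have h := Finset.card_filter_add_card_filter_not (s := (Finset.univ : Finset (Fin n)))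
    fun i : Fin n => n - n / 2 ≤ (i : ℕ)
  rw [card_upper, Finset.card_univ, Fintype.card_fin] at h
  simp only [not_le] at h
  rw [lowers]
  omega

/-- Every insertion order creates many conflicts, as sorting the lower pile does. -/
theorem mul_le_work (π : Equiv.Perm (Fin n)) (d : ℕ) :
    (n - n / 2 - 2 ^ d) * d ≤ work (pile n) π := by
  classical
  let f : Fin n → ℕ := fun i => (π.symm i : ℕ)
  have hf : Function.Injective f := Fin.val_injective.comp π.symm.injective
  -- `P s x` makes `x` an ancestor of `s` in the search tree of the lower pile. Each such pair
  -- yields a new edge by `created_nonempty`, and all but fewer than `2 ^ d` of the `s` have at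
  -- least `d` ancestors.
  let P : Fin n → Fin n → Prop := fun s x => f x < f s ∧
      ∀ y ∈ lowers n, min x s < y → y < max x s → f x ≤ f y
  have h1 : ((lowers n).filter fun s => ((lowers n).filter (P s)).card < d).card < 2 ^ d := by
    convert card_depth_lt f hf d (lowers n)
  have h2 := Finset.card_filter_add_card_filter_not (s := lowers n)
    fun s => ((lowers n).filter (P s)).card < d
  rw [card_lowers] at h2
  have h3 : ((lowers n).filter fun s => ¬ ((lowers n).filter (P s)).card < d).card * d ≤
      ∑ s ∈ lowers n, ((lowers n).filter (P s)).card := by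
    rw [← smul_eq_mul, ← Finset.sum_const]
    exact (Finset.sum_le_sum fun s hs => not_lt.1 (Finset.mem_filter.1 hs).2).trans
      (Finset.sum_le_sum_of_subset (Finset.filter_subset _ _))
  refine (Nat.mul_le_mul_right d (by omega)).trans (h3.trans ?_)
  rw [work_pile]
  simp only [Finset.card_filter]
  rw [Finset.sum_comm]
  refine (Finset.sum_le_sum fun x hx => ?_).trans
    (Finset.sum_le_sum_of_subset (Finset.subset_univ (lowers n)))
  calc (∑ s ∈ lowers n, if P s x then 1 else 0) = ∑ s ∈ (lowers n).filter (P · x), 1 := by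
        rw [Finset.sum_filter]
    _ ≤ ∑ s ∈ (lowers n).filter (P · x), (created (before π x) x s).ncard := by
        refine Finset.sum_le_sum fun s hs => ?_
        obtain ⟨hs1, hs2, hs3⟩ := Finset.mem_filter.1 hs
        have hxs : x ≠ s := by rintro rfl; exact lt_irrefl _ hs2
        rw [mem_lowers] at hx hs1
        rw [Nat.one_le_iff_ne_zero, ← Nat.pos_iff_ne_zero, Set.ncard_pos (created_finite _ _ _)]
        refine created_nonempty hx hs1 hxs ?_ ?_ fun y hy => ?_
        · rw [mem_before]; exact lt_irrefl _
        · rw [mem_before]; exact not_lt.2 (Fin.le_def.2 hs2.le)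
        · rw [mem_before, not_lt]
          obtain ⟨h4, h5, h6⟩ := mem_between.1 hy
          have h7 : ((max x s : Fin n) : ℕ) < n - n / 2 := by
            rcases max_choice x s with h | h <;> rw [h] <;> assumption
          exact hs3 y (mem_lowers.2 ((Fin.lt_def.1 h5).trans h7)) h4 h5
    _ ≤ _ := Finset.sum_le_sum_of_subset fun s hs => by
        obtain ⟨hs1, hs2, hs3⟩ := Finset.mem_filter.1 hs
        exact Finset.mem_filter.2 ⟨Finset.mem_univ _, Fin.lt_def.2 hs2⟩

/-- Prescription for the first segments: `t` lower ones, then one upper segment from each of the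
topmost blocks of `w` segments, in descending order. -/
def schedule (n t w : ℕ) (k : ℕ) : Finset (Fin n) :=
  if k < t then lowers n else
    Finset.univ.filter fun i : Fin n => n ≤ i + (k - t + 1) * w ∧ i + (k - t) * w < n

/-- If the insertion order follows the schedule, then the work is large. -/
theorem mul_le_work_of_schedule {π : Equiv.Perm (Fin n)} {t w r q : ℕ}
    (h : n - n / 2 + q + r * w ≤ n) (htr : t + r ≤ n) (hπ : π ∈ prefixIn (schedule n t w) (t + r)) :
    r * (q * t) ≤ work (pile n) π := by
  classical
  rw [mem_prefixIn] at hπ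
  have hlow : ∀ i : Fin n, (i : ℕ) < t → (π i : ℕ) < n - n / 2 := by
    intro i hi
    have := hπ i (by omega)
    rwa [schedule, if_pos hi, mem_lowers] at this
  have hup : ∀ i : Fin n, ∀ j < r, (i : ℕ) = t + j →
      n ≤ π i + (j + 1) * w ∧ π i + j * w < n := by
    intro i j hj hi
    have := hπ i (by omega)
    rw [schedule, if_neg (by omega), Finset.mem_filter] at this
    rw [hi, Nat.add_sub_cancel_left] at this
    exact this.2
  have hup' : ∀ i : Fin n, t ≤ (i : ℕ) → (i : ℕ) < t + r → n - n / 2 + q ≤ (π i : ℕ) := by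
    intro i h1 h2
    have h3 := (hup i (i - t) (by omega) (by omega)).1
    have h4 : ((i : ℕ) - t + 1) * w ≤ r * w := Nat.mul_le_mul_right w (by omega)
    omega
  let X : Finset (Fin n) := (Finset.univ.filter fun i : Fin n => t ≤ (i : ℕ) ∧ (i : ℕ) < t + r).map
    π.toEmbedding
  -- The `q` lowest upper segments lie below every scheduled block, so they are still waiting during
  -- all `r` upper insertions.
  let Q : Finset (Fin n) := Finset.univ.filter fun i : Fin n =>
    n - n / 2 ≤ (i : ℕ) ∧ (i : ℕ) < n - n / 2 + q
  have hIco : ∀ a b : ℕ, b ≤ n →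
      (Finset.univ.filter fun i : Fin n => a ≤ (i : ℕ) ∧ (i : ℕ) < b).card = b - a := by
    intro a b hb
    rw [← Nat.card_Ico, ← Finset.card_map Fin.valEmbedding]
    congr 1
    ext k
    simp only [Finset.mem_map, Finset.mem_filter, Finset.mem_univ, true_and,
      Fin.valEmbedding_apply, Finset.mem_Ico]
    exact ⟨fun ⟨i, h1, h2⟩ => h2 ▸ h1, fun h => ⟨⟨k, h.2.trans_le hb⟩, h, rfl⟩⟩
  have hX : X.card = r := by
    rw [Finset.card_map, hIco _ _ htr, Nat.add_sub_cancel_left]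
  have hQ : Q.card = q := by
    rw [hIco _ _ (by omega), Nat.add_sub_cancel_left]
  let D : Finset (Fin n) := (Finset.univ.filter fun i : Fin n => 0 ≤ (i : ℕ) ∧ (i : ℕ) < t).map
    π.toEmbedding
  have hD : D.card = t := by rw [Finset.card_map, hIco _ _ (by omega), Nat.sub_zero]
  rw [work_pile]
  calc r * (q * t) = ∑ x ∈ X, ∑ s ∈ Q, D.card := by
        rw [Finset.sum_const, Finset.sum_const, hX, hQ, hD, smul_eq_mul, smul_eq_mul]
    _ ≤ ∑ x ∈ X, ∑ s ∈ Q, (created (before π x) x s).ncard := by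
        refine Finset.sum_le_sum fun x hx => Finset.sum_le_sum fun s hs => ?_
        obtain ⟨k, hk, rfl⟩ := Finset.mem_map.1 hx
        obtain ⟨-, hk1, hk2⟩ := Finset.mem_filter.1 hk
        obtain ⟨-, hs1, hs2⟩ := Finset.mem_filter.1 hs
        refine card_le_ncard_created (fun b hb => ?_) (fun b hb => ?_) hs1 ?_ fun i hi hiu => ?_
        · obtain ⟨l, hl, rfl⟩ := Finset.mem_map.1 hb
          rw [mem_before]
          simp only [Equiv.coe_toEmbedding, Equiv.symm_apply_apply]
          exact Fin.lt_def.2 ((Finset.mem_filter.1 hl).2.2.trans_le hk1)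
        · obtain ⟨l, hl, rfl⟩ := Finset.mem_map.1 hb
          exact hlow l (Finset.mem_filter.1 hl).2.2
        · exact Fin.lt_def.2 (hs2.trans_le (hup' k hk1 hk2))
        · rw [mem_before] at hi
          simp only [Equiv.coe_toEmbedding, Equiv.symm_apply_apply] at hi ⊢
          have hi' := Fin.lt_def.1 hi
          have h1 : t ≤ (π.symm i : ℕ) := by
            by_contra! h'
            have := hlow _ h'
            rw [Equiv.apply_symm_apply] at this
            omega
          have h2 := (hup (π.symm i) (π.symm i - t : ℕ) (by omega) (by omega)).1
          have h3 := (hup k (k - t : ℕ) (by omega) (by omega)).2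
          rw [Equiv.apply_symm_apply] at h2
          have h4 : ((π.symm i : ℕ) - t + 1) * w ≤ (k - t) * w :=
            Nat.mul_le_mul_right w (by omega)
          exact Fin.lt_def.2 (by omega)
    _ ≤ ∑ x ∈ X, ∑ s ∈ Finset.univ.filter fun s => π.symm x < π.symm s,
          (created (before π x) x s).ncard := by
        refine Finset.sum_le_sum fun x hx => Finset.sum_le_sum_of_subset fun s hs => ?_
        obtain ⟨k, hk, rfl⟩ := Finset.mem_map.1 hx
        obtain ⟨-, hk1, hk2⟩ := Finset.mem_filter.1 hk
        obtain ⟨-, hs1, hs2⟩ := Finset.mem_filter.1 hs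
        refine Finset.mem_filter.2 ⟨Finset.mem_univ _, ?_⟩
        simp only [Equiv.coe_toEmbedding, Equiv.symm_apply_apply]
        rw [Fin.lt_def]
        by_contra! h'
        rcases lt_or_ge (π.symm s : ℕ) t with h1 | h1
        · have := hlow _ h1
          rw [Equiv.apply_symm_apply] at this
          omega
        · have := hup' _ h1 (by omega)
          rw [Equiv.apply_symm_apply] at this
          omega
    _ ≤ _ := Finset.sum_le_sum_of_subset (Finset.subset_univ X)

/-- The work is at most a sum over pairs and triples of segments of indicators of events which
only concern the relative order of the segments. -/
theorem work_le (π : Equiv.Perm (Fin n)) :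
    work (pile n) π ≤ ∑ x, ∑ s ∈ Finset.univ.filter fun s => s ≠ x,
      ((if ∀ y ∈ insert x (between x s), π.symm x ≤ π.symm y then 6 else 0) +
        ∑ b ∈ lowers n, if (n - n / 2 ≤ (s : ℕ) ∧ s < x) ∧ (π.symm b < π.symm x ∧
          ∀ y ∈ Finset.univ.filter fun y : Fin n => n - n / 2 ≤ (y : ℕ) ∧ y ≤ x,
            π.symm x ≤ π.symm y) then 2 else 0) := by
  rw [work_pile]
  refine Finset.sum_le_sum fun x _ => ?_
  refine (Finset.sum_le_sum fun s hs => ?_).trans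
    (Finset.sum_le_sum_of_subset fun s hs => ?_)
  · have hs' := (Finset.mem_filter.1 hs).2
    have hxs : x ≠ s := by rintro rfl; exact lt_irrefl _ hs'
    refine (ncard_created_le (R := before π x) ?_ hxs).trans (add_le_add ?_ ?_)
    · rw [mem_before]; exact not_lt.2 hs'.le
    · split_ifs with h1 h2 h2
      · exact le_rfl
      · refine absurd (fun y hy => ?_) h2
        rcases Finset.mem_insert.1 hy with rfl | hy
        · exact le_rfl
        · have := h1 y hy
          rwa [mem_before, not_lt] at this
      · exact Nat.zero_le _
      · exact le_rfl
    · split_ifs with h1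
      · obtain ⟨h1, h2, h3⟩ := h1
        rw [mul_comm, ← smul_eq_mul, ← Finset.sum_const, ← Finset.sum_filter]
        refine Finset.sum_le_sum_of_subset fun b hb => ?_
        obtain ⟨hb1, hb2⟩ := Finset.mem_filter.1 hb
        refine Finset.mem_filter.2 ⟨mem_lowers.2 hb2, ⟨h1, h2⟩, mem_before.1 hb1, fun y hy => ?_⟩
        obtain ⟨-, hy1, hy2⟩ := Finset.mem_filter.1 hy
        rcases hy2.lt_or_eq with hy2 | rfl
        · have := h3 y hy1 hy2
          rwa [mem_before, not_lt] at this
        · exact le_rfl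
      · exact Nat.zero_le _
  · have hs' := (Finset.mem_filter.1 hs).2
    refine Finset.mem_filter.2 ⟨Finset.mem_univ _, ?_⟩
    rintro rfl; exact lt_irrefl _ hs'

/-! ### The expected work -/

/-- Inversion preserves the uniform distribution, so the insertion times `π.symm` may be replaced by
a uniform permutation. -/
theorem sum_ite_symm (P : Equiv.Perm (Fin n) → Prop) [DecidablePred P] (c : ℕ) :
    ∑ π : Equiv.Perm (Fin n), (if P π.symm then c else 0) =
      (Finset.univ.filter P).card * c := by
  refine (Equiv.sum_comp (Equiv.inv (Equiv.Perm (Fin n))) fun p => if P p then c else 0).trans ?_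
  rw [← Finset.sum_filter, Finset.sum_const, smul_eq_mul]

theorem sum_work_le : ∑ π : Equiv.Perm (Fin n), work (pile n) π ≤
    ∑ x, ∑ s ∈ Finset.univ.filter fun s : Fin n => s ≠ x,
      ((Finset.univ.filter fun p : Equiv.Perm (Fin n) =>
          ∀ y ∈ insert x (between x s), p x ≤ p y).card * 6 +
        ∑ b ∈ lowers n, if n - n / 2 ≤ (s : ℕ) ∧ s < x then
          (Finset.univ.filter fun p : Equiv.Perm (Fin n) => p b < p x ∧
            ∀ y ∈ Finset.univ.filter fun y : Fin n => n - n / 2 ≤ (y : ℕ) ∧ y ≤ x,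
              p x ≤ p y).card * 2 else 0) := by
  refine (Finset.sum_le_sum fun π _ => work_le π).trans_eq ?_
  rw [Finset.sum_comm]
  refine Finset.sum_congr rfl fun x _ => ?_
  rw [Finset.sum_comm]
  refine Finset.sum_congr rfl fun s _ => ?_
  rw [Finset.sum_add_distrib, Finset.sum_comm]
  congr 1
  · exact sum_ite_symm (fun p => ∀ y ∈ insert x (between x s), p x ≤ p y) 6
  · refine Finset.sum_congr rfl fun b _ => ?_
    by_cases h : n - n / 2 ≤ (s : ℕ) ∧ s < x
    · simp only [h, true_and, if_true]
      exact sum_ite_symm (fun p => p b < p x ∧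
        ∀ y ∈ Finset.univ.filter fun y : Fin n => n - n / 2 ≤ (y : ℕ) ∧ y ≤ x, p x ≤ p y) 2
    · simp only [h, false_and, if_false, Finset.sum_const_zero]

theorem sum_inv_le_harmonic (A : Finset (Fin n)) (h : Fin n → ℕ) (hinj : Set.InjOn h A)
    (hlt : ∀ a ∈ A, h a < n) :
    ∑ a ∈ A, ((h a : ℝ) + 1)⁻¹ ≤ ∑ k ∈ Finset.range n, ((k : ℝ) + 1)⁻¹ := by
  rw [← Finset.sum_image (f := fun k : ℕ => ((k : ℝ) + 1)⁻¹) hinj]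
  refine Finset.sum_le_sum_of_subset_of_nonneg (fun k hk => ?_) fun k _ _ => by positivity
  obtain ⟨a, ha, rfl⟩ := Finset.mem_image.1 hk
  exact Finset.mem_range.2 (hlt a ha)

/-- A bound for the reciprocal of the number of segments between `x` and `s`, including `x`. -/
noncomputable def gap (x s : Fin n) : ℝ :=
  (if s < x then (((x - s - 1 : ℕ) : ℝ) + 1)⁻¹ else 0) +
  (if x < s then (((s - x - 1 : ℕ) : ℝ) + 1)⁻¹ else 0) +
  (if n - n / 2 ≤ (x : ℕ) then (((x - (n - n / 2) : ℕ) : ℝ) + 1)⁻¹ else 0) +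
  (if n - n / 2 ≤ (s : ℕ) then (((s - (n - n / 2) : ℕ) : ℝ) + 1)⁻¹ else 0)

/-- With the other variable fixed, each of the four summands runs over distinct reciprocals and is
at most one harmonic sum. -/
theorem sum_gap_le : ∑ x : Fin n, ∑ s : Fin n, gap x s ≤
    4 * (n * ∑ k ∈ Finset.range n, ((k : ℝ) + 1)⁻¹) := by
  have key : ∀ (P : Fin n → Prop) [DecidablePred P] (h : Fin n → ℕ),
      (∀ a, P a → h a < n) → (∀ a b, P a → P b → h a = h b → a = b) →
      ∑ a, (if P a then ((h a : ℝ) + 1)⁻¹ else 0) ≤ ∑ k ∈ Finset.range n, ((k : ℝ) + 1)⁻¹ := by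
    intro P _ h h1 h2
    rw [← Finset.sum_filter]
    exact sum_inv_le_harmonic _ h
      (fun a ha b hb => h2 a b (by simpa using ha) (by simpa using hb))
      fun a ha => h1 a (Finset.mem_filter.1 ha).2
  have hc : ∀ c : ℝ, ∑ _x : Fin n, c = n * c := fun c => by simp
  simp only [gap, Finset.sum_add_distrib]
  have h1 : ∑ x : Fin n, ∑ s : Fin n, (if s < x then (((x - s - 1 : ℕ) : ℝ) + 1)⁻¹ else 0) ≤
      n * ∑ k ∈ Finset.range n, ((k : ℝ) + 1)⁻¹ := by
    rw [← hc]
    refine Finset.sum_le_sum fun x _ => key (· < x) (fun s => x - s - 1) ?_ ?_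
    · intro a _; omega
    · intro a b ha hb h; exact Fin.ext (by rw [Fin.lt_def] at ha hb; omega)
  have h2 : ∑ x : Fin n, ∑ s : Fin n, (if x < s then (((s - x - 1 : ℕ) : ℝ) + 1)⁻¹ else 0) ≤
      n * ∑ k ∈ Finset.range n, ((k : ℝ) + 1)⁻¹ := by
    rw [← hc]
    refine Finset.sum_le_sum fun x _ => key (x < ·) (fun s => s - x - 1) ?_ ?_
    · intro a _; omega
    · intro a b ha hb h; exact Fin.ext (by rw [Fin.lt_def] at ha hb; omega)
  have h4 : ∑ s : Fin n,
      (if n - n / 2 ≤ (s : ℕ) then (((s - (n - n / 2) : ℕ) : ℝ) + 1)⁻¹ else 0) ≤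
      ∑ k ∈ Finset.range n, ((k : ℝ) + 1)⁻¹ :=
    key (fun s : Fin n => n - n / 2 ≤ (s : ℕ)) (fun s => s - (n - n / 2))
      (fun a _ => by omega) (fun a b ha hb h => Fin.ext (by omega))
  have h3 : ∑ x : Fin n, ∑ s : Fin n,
      (if n - n / 2 ≤ (x : ℕ) then (((x - (n - n / 2) : ℕ) : ℝ) + 1)⁻¹ else 0) ≤
      n * ∑ k ∈ Finset.range n, ((k : ℝ) + 1)⁻¹ := by
    rw [Finset.sum_comm, ← hc]
    exact Finset.sum_le_sum fun _ _ => h4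
  have h5 : ∑ x : Fin n, ∑ s : Fin n,
      (if n - n / 2 ≤ (s : ℕ) then (((s - (n - n / 2) : ℕ) : ℝ) + 1)⁻¹ else 0) ≤
      n * ∑ k ∈ Finset.range n, ((k : ℝ) + 1)⁻¹ := by
    rw [← hc]
    exact Finset.sum_le_sum fun _ _ => h4
  linarith

/-- Within one pile all indices strictly between `x` and `s` separate them. Across the piles, all
upper segments beneath the upper one of the two do. The matching summand of `gap` suffices, the
others being nonnegative. -/
theorem one_le_card_mul_gap {x s : Fin n} (h : s ≠ x) :
    1 ≤ ((insert x (between x s)).card : ℝ) * gap x s := by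
  have hx : x ∉ between x s := fun h' => by
    obtain ⟨h1, h2, -⟩ := mem_between.1 h'
    rcases le_total x s with h3 | h3
    · rw [min_eq_left h3] at h1; exact lt_irrefl _ h1
    · rw [max_eq_left h3] at h2; exact lt_irrefl _ h2
  rw [Finset.card_insert_of_notMem hx]
  have key : ∀ k : ℕ, k ≤ (between x s).card → ((k : ℝ) + 1)⁻¹ ≤ gap x s →
      1 ≤ (((between x s).card + 1 : ℕ) : ℝ) * gap x s := by
    intro k hk hg
    have h0 : (0 : ℝ) < (k : ℝ) + 1 := by positivity
    calc (1 : ℝ) = ((k : ℝ) + 1) * ((k : ℝ) + 1)⁻¹ := (mul_inv_cancel₀ h0.ne').symm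
      _ ≤ _ := by
        refine mul_le_mul ?_ hg (by positivity) (by positivity)
        push_cast
        have : (k : ℝ) ≤ ((between x s).card : ℝ) := by exact_mod_cast hk
        linarith
  have hnn : ∀ (P : Prop) [Decidable P] (k : ℕ), 0 ≤ (if P then ((k : ℝ) + 1)⁻¹ else 0) := by
    intro P _ k
    split_ifs <;> positivity
  have g1 := hnn (s < x) (x - s - 1)
  have g2 := hnn (x < s) (s - x - 1)
  have g3 := hnn (n - n / 2 ≤ (x : ℕ)) (x - (n - n / 2))
  have g4 := hnn (n - n / 2 ≤ (s : ℕ)) (s - (n - n / 2))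
  have hIoo : ((max x s : Fin n) : ℕ) < n - n / 2 ∨ n - n / 2 ≤ ((min x s : Fin n) : ℕ) →
      (max x s : Fin n) - (min x s : Fin n) - 1 ≤ (between x s).card := by
    intro h'
    rw [← Fin.card_Ioo]
    refine Finset.card_le_card fun y hy => ?_
    obtain ⟨h1, h2⟩ := Finset.mem_Ioo.1 hy
    refine mem_between.2 ⟨h1, h2, ?_⟩
    rcases h' with h' | h'
    · exact Or.inr h'
    · exact Or.inl (h'.trans (Fin.lt_def.1 h1).le)
  have hIco : ((min x s : Fin n) : ℕ) < n - n / 2 → ∀ h' : n - n / 2 ≤ ((max x s : Fin n) : ℕ),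
      ((max x s : Fin n) : ℕ) - (n - n / 2) ≤ (between x s).card := by
    intro h1 h'
    have := Fin.card_Ico ⟨n - n / 2, h'.trans_lt (max x s).2⟩ (max x s)
    rw [← this]
    refine Finset.card_le_card fun y hy => ?_
    obtain ⟨h3, h4⟩ := Finset.mem_Ico.1 hy
    rw [Fin.le_def] at h3
    exact mem_between.2 ⟨Fin.lt_def.2 (h1.trans_le h3), h4, Or.inl h3⟩
  rcases h.lt_or_gt with h | h
  · rw [min_eq_right h.le, max_eq_left h.le] at hIoo hIco
    by_cases hc : (x : ℕ) < n - n / 2 ∨ n - n / 2 ≤ (s : ℕ)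
    · refine key _ (hIoo hc) ?_
      rw [if_pos h] at g1
      rw [gap, if_pos h]
      linarith
    · push Not at hc
      refine key _ (hIco hc.2 hc.1) ?_
      rw [if_pos hc.1] at g3
      rw [gap, if_pos hc.1]
      linarith
  · rw [min_eq_left h.le, max_eq_right h.le] at hIoo hIco
    by_cases hc : (s : ℕ) < n - n / 2 ∨ n - n / 2 ≤ (x : ℕ)
    · refine key _ (hIoo hc) ?_
      rw [if_pos h] at g2
      rw [gap, if_pos h]
      linarith
    · push Not at hc
      refine key _ (hIco hc.2 hc.1) ?_
      rw [if_pos hc.1] at g4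
      rw [gap, if_pos hc.1]
      linarith

theorem sum_work_le_harmonic : ((∑ π : Equiv.Perm (Fin n), work (pile n) π : ℕ) : ℝ) ≤
    n.factorial * (26 * (n * ∑ k ∈ Finset.range n, ((k : ℝ) + 1)⁻¹)) := by
  classical
  have hgap : ∀ x s : Fin n, 0 ≤ gap x s := fun x s => by
    unfold gap
    have hnn : ∀ (P : Prop) [Decidable P] (k : ℕ), 0 ≤ (if P then ((k : ℝ) + 1)⁻¹ else 0) := by
      intro P _ k
      split_ifs <;> positivity
    exact add_nonneg (add_nonneg (add_nonneg (hnn _ _) (hnn _ _)) (hnn _ _)) (hnn _ _)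
  have hpair : ∀ x s : Fin n, s ≠ x → ((Finset.univ.filter fun p : Equiv.Perm (Fin n) =>
      ∀ y ∈ insert x (between x s), p x ≤ p y).card : ℝ) ≤ n.factorial * gap x s := by
    intro x s hxs
    have h1 : ((Finset.univ.filter fun p : Equiv.Perm (Fin n) =>
        ∀ y ∈ insert x (between x s), p x ≤ p y).card : ℝ) *
        ((insert x (between x s)).card : ℝ) ≤ n.factorial := by
      exact_mod_cast card_first_mul_le (Finset.mem_insert_self x (between x s))
    have h2 := one_le_card_mul_gap hxs
    calc _ ≤ ((Finset.univ.filter fun p : Equiv.Perm (Fin n) =>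
        ∀ y ∈ insert x (between x s), p x ≤ p y).card : ℝ) *
          (((insert x (between x s)).card : ℝ) * gap x s) :=
          le_mul_of_one_le_right (Nat.cast_nonneg _) h2
      _ ≤ _ := by
          rw [← mul_assoc]
          exact mul_le_mul_of_nonneg_right h1 (hgap x s)
  -- With `k` upper segments below `x`, the event has probability at most `1 / ((k + 1) (k + 2))`
  -- and concerns at most `k` choices of `s`; the product is at most `1 / (k + 1)`.
  have htriple : ∀ x b : Fin n, b ∈ lowers n → n - n / 2 ≤ (x : ℕ) →
      ((Finset.univ.filter fun p : Equiv.Perm (Fin n) => p b < p x ∧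
            ∀ y ∈ Finset.univ.filter fun y : Fin n => n - n / 2 ≤ (y : ℕ) ∧ y ≤ x,
              p x ≤ p y).card : ℝ) * (x - (n - n / 2) : ℕ) ≤
        n.factorial * (((x - (n - n / 2) : ℕ) : ℝ) + 1)⁻¹ := by
    intro x b hb hx
    set L := Finset.univ.filter fun y : Fin n => n - n / 2 ≤ (y : ℕ) ∧ y ≤ x with hL
    have hLcard : L.card = x - (n - n / 2) + 1 := by
      have : L = Finset.Icc ⟨n - n / 2, hx.trans_lt x.2⟩ x := by
        ext y
        simp only [hL, Finset.mem_filter, Finset.mem_univ, true_and, Finset.mem_Icc, Fin.le_def]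
      rw [this, Fin.card_Icc]
      simp only
      omega
    have hbL : b ∉ L := fun h => by
      have h1 := (Finset.mem_filter.1 h).2.1
      have h2 := mem_lowers.1 hb
      omega
    have hxL : x ∈ L := Finset.mem_filter.2 ⟨Finset.mem_univ _, hx, le_rfl⟩
    have h1 := card_first_second_mul_le hbL hxL
    rw [hLcard] at h1
    set k : ℕ := x - (n - n / 2)
    set G := (Finset.univ.filter fun p : Equiv.Perm (Fin n) => p b < p x ∧
      ∀ y ∈ L, p x ≤ p y).card
    have h2 : (G : ℝ) * (((k : ℝ) + 1) * ((k : ℝ) + 1 + 1)) ≤ n.factorial := by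
      exact_mod_cast h1
    rw [← div_eq_mul_inv, le_div_iff₀ (by positivity)]
    refine le_trans ?_ h2
    have hG : (0 : ℝ) ≤ G := Nat.cast_nonneg _
    have hk : (0 : ℝ) ≤ k := Nat.cast_nonneg _
    have : (k : ℝ) * (k + 1) ≤ (k + 1) * (k + 1 + 1) := by nlinarith
    calc (G : ℝ) * k * (k + 1) = G * (k * (k + 1)) := by ring
      _ ≤ _ := mul_le_mul_of_nonneg_left this hG
  refine (Nat.cast_le.2 sum_work_le).trans ?_
  push_cast
  have hH : ∑ x : Fin n, (if n - n / 2 ≤ (x : ℕ) then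
      (((x - (n - n / 2) : ℕ) : ℝ) + 1)⁻¹ else 0) ≤
      ∑ k ∈ Finset.range n, ((k : ℝ) + 1)⁻¹ := by
    rw [← Finset.sum_filter]
    refine sum_inv_le_harmonic _ (fun x : Fin n => x - (n - n / 2)) (fun a ha b hb h => ?_)
      fun a _ => by omega
    simp only [Finset.coe_filter, Finset.mem_univ, true_and, Set.mem_ofPred_eq] at ha hb
    exact Fin.ext (by simp only at h; omega)
  -- The final constant is 26 = 6 · 4 + 2, from pairs and triples respectively.
  calc _ ≤ ∑ x : Fin n, ((∑ s : Fin n, n.factorial * gap x s * 6) +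
        n.factorial * (2 * (n * (if n - n / 2 ≤ (x : ℕ) then
          (((x - (n - n / 2) : ℕ) : ℝ) + 1)⁻¹ else 0)))) := by
        refine Finset.sum_le_sum fun x _ => ?_
        rw [Finset.sum_add_distrib]
        refine add_le_add ?_ ?_
        · refine (Finset.sum_le_sum fun s hs => ?_).trans
            (Finset.sum_le_sum_of_subset_of_nonneg (Finset.subset_univ _) fun s _ _ =>
              mul_nonneg (mul_nonneg (Nat.cast_nonneg _) (hgap x s)) (by norm_num))
          exact mul_le_mul_of_nonneg_right (hpair x s (Finset.mem_filter.1 hs).2) (by norm_num)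
        · rw [Finset.sum_comm]
          by_cases hx : n - n / 2 ≤ (x : ℕ)
          swap
          · rw [if_neg hx, mul_zero, mul_zero, mul_zero]
            refine (Finset.sum_eq_zero fun b _ => Finset.sum_eq_zero fun s _ => if_neg ?_).le
            rintro ⟨h1, h2⟩
            exact hx (h1.trans (Fin.lt_def.1 h2).le)
          rw [if_pos hx]
          have hn : ∑ _b ∈ lowers n,
              n.factorial * (2 * (((x - (n - n / 2) : ℕ) : ℝ) + 1)⁻¹) ≤
              n.factorial * (2 * (n * (((x - (n - n / 2) : ℕ) : ℝ) + 1)⁻¹)) := by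
            rw [Finset.sum_const, card_lowers, nsmul_eq_mul]
            have h1 : ((n - n / 2 : ℕ) : ℝ) ≤ n := by exact_mod_cast Nat.sub_le n (n / 2)
            calc _ ≤ (n : ℝ) * (n.factorial * (2 * (((x - (n - n / 2) : ℕ) : ℝ) + 1)⁻¹)) := by
                  gcongr
              _ = _ := by ring
          refine (Finset.sum_le_sum fun b hb => ?_).trans hn
          rw [← Finset.sum_filter, Finset.sum_const, nsmul_eq_mul]
          have hcard : ((Finset.univ.filter fun s : Fin n => s ≠ x).filter fun s : Fin n =>
              n - n / 2 ≤ (s : ℕ) ∧ s < x).card ≤ x - (n - n / 2) := by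
            rw [← Fin.card_Ico ⟨n - n / 2, hx.trans_lt x.2⟩ x]
            refine Finset.card_le_card fun s hs => ?_
            exact Finset.mem_Ico.2 (Finset.mem_filter.1 hs).2
          have h1 := htriple x b hb hx
          refine (mul_le_mul_of_nonneg_right (Nat.cast_le.2 hcard) (by positivity)).trans ?_
          linarith
    _ = 6 * n.factorial * (∑ x : Fin n, ∑ s : Fin n, gap x s) +
        n.factorial * (2 * (n * ∑ x : Fin n, (if n - n / 2 ≤ (x : ℕ) then
          (((x - (n - n / 2) : ℕ) : ℝ) + 1)⁻¹ else 0))) := by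
        rw [Finset.sum_add_distrib, ← Finset.mul_sum, ← Finset.mul_sum, ← Finset.mul_sum]
        simp only [← Finset.sum_mul, ← Finset.mul_sum]
        ring
    _ ≤ 6 * n.factorial * (4 * (n * ∑ k ∈ Finset.range n, ((k : ℝ) + 1)⁻¹)) +
        n.factorial * (2 * (n * ∑ k ∈ Finset.range n, ((k : ℝ) + 1)⁻¹)) := by
        gcongr
        exact sum_gap_le
    _ = _ := by ring

/-- The expected work is `O(n log n)`. -/
theorem expectedWork_le (hn : n ≠ 0) :
    expectedWork (pile n) ≤ 26 * (n * (1 + Real.log n)) := by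
  have h1 : (∑ π : Equiv.Perm (Fin n), (work (pile n) π : ℝ)) ≤
      n.factorial * (26 * (n * ∑ k ∈ Finset.range n, ((k : ℝ) + 1)⁻¹)) := by
    exact_mod_cast sum_work_le_harmonic (n := n)
  have h2 : ∑ k ∈ Finset.range n, ((k : ℝ) + 1)⁻¹ ≤ 1 + Real.log n := by
    have := harmonic_le_one_add_log n
    rw [harmonic] at this
    push_cast at this
    exact this
  have h3 : (0 : ℝ) < n.factorial := by exact_mod_cast n.factorial_pos
  rw [expectedWork, Nat.card_eq_fintype_card, Fintype.card_perm, Fintype.card_fin,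
    div_le_iff₀ h3, mul_comm]
  refine h1.trans ?_
  gcongr

/-! ### The tail of the work -/

theorem prob_eq (E : Equiv.Perm (Fin n) → Prop) [DecidablePred E] :
    prob E = ((Finset.univ.filter E).card : ℝ) / n.factorial := by
  rw [prob, Nat.card_eq_fintype_card, Nat.card_eq_fintype_card, Fintype.card_subtype,
    Fintype.card_perm, Fintype.card_fin]

theorem le_prob {E : Equiv.Perm (Fin n) → Prop} {P : Finset (Equiv.Perm (Fin n))} {a : ℝ}
    (hP : n.factorial * a ≤ P.card) (h : ∀ π ∈ P, E π) : a ≤ prob E := by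
  classical
  have h0 : (0 : ℝ) < n.factorial := by exact_mod_cast n.factorial_pos
  rw [prob_eq, le_div_iff₀ h0, mul_comm]
  refine hP.trans (Nat.cast_le.2 (Finset.card_le_card fun π hπ => ?_))
  exact Finset.mem_filter.2 ⟨Finset.mem_univ _, h π hπ⟩

theorem prob_mono {E E' : Equiv.Perm (Fin n) → Prop} (h : ∀ π, E π → E' π) :
    prob E ≤ prob E' := by
  classical
  have h0 : (0 : ℝ) < n.factorial := by exact_mod_cast n.factorial_pos
  refine le_prob (P := Finset.univ.filter E) ?_ fun π hπ => h π (Finset.mem_filter.1 hπ).2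
  rw [prob_eq, mul_div_cancel₀ _ h0.ne']

theorem one_le_prob {E : Equiv.Perm (Fin n) → Prop} (h : ∀ π, E π) : 1 ≤ prob E := by
  refine le_prob (P := Finset.univ) ?_ fun π _ => h π
  rw [Finset.card_univ, Fintype.card_perm, Fintype.card_fin, mul_one]

/-- For every insertion order the work is at least of order `n log n`. -/
theorem eventually_le_work : ∀ᶠ n : ℕ in atTop, ∀ π : Equiv.Perm (Fin n),
    1 / 16 * (n * Real.log n) ≤ (work (pile n) π : ℝ) := by
  have hlog : Tendsto (fun n : ℕ => Real.log n) atTop atTop :=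
    Real.tendsto_log_atTop.comp tendsto_natCast_atTop_atTop
  filter_upwards [hlog.eventually_ge_atTop 8, eventually_ge_atTop 8] with n hL hn π
  have hpos : (0 : ℝ) < n := by exact_mod_cast (show 0 < n by omega)
  -- With `2 ^ d ≤ n / 4`, about a quarter of all segments are lower ones of depth at least `d`.
  set d := Nat.log 2 (n / 4)
  have h1 : 2 ^ d ≤ n / 4 := Nat.pow_log_le_self 2 (by omega)
  have h2 : n / 4 < 2 ^ (d + 1) := Nat.lt_pow_succ_log_self (by norm_num) _
  have h3 : (n : ℝ) ≤ 4 * 2 ^ (d + 1) := by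
    have : n ≤ 4 * 2 ^ (d + 1) := by omega
    exact_mod_cast this
  have h4 : Real.log n ≤ d + 3 := by
    have h5 := Real.log_le_log hpos h3
    have h6 : (4 : ℝ) * 2 ^ (d + 1) = 2 ^ (d + 3) := by ring
    rw [h6, Real.log_pow] at h5
    have h7 : Real.log 2 ≤ 1 := by linarith [Real.log_two_lt_d9]
    push_cast at h5
    nlinarith [Nat.cast_nonneg (α := ℝ) d]
  have h8 : n * d ≤ 4 * work (pile n) π + 3 * d := by
    have := mul_le_work π d
    have h9 : n / 4 * d ≤ (n - n / 2 - 2 ^ d) * d := Nat.mul_le_mul_right d (by omega)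
    have h10 : n ≤ 4 * (n / 4) + 3 := by omega
    calc n * d ≤ (4 * (n / 4) + 3) * d := Nat.mul_le_mul_right d h10
      _ = 4 * (n / 4 * d) + 3 * d := by ring
      _ ≤ _ := by omega
  have h11 : (n : ℝ) * d ≤ 4 * work (pile n) π + 3 * d := by exact_mod_cast h8
  have h12 : (8 : ℝ) ≤ n := by exact_mod_cast hn
  have h13 : Real.log n / 2 ≤ d := by linarith
  nlinarith [mul_le_mul h12 h13 (by linarith) hpos.le]

/-- A lower bound for the probability that the first `t` segments are lower ones and are followed
by `r` upper ones in descending order. -/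
theorem schedule_prob {t r : ℕ} (hr : 1 ≤ r) (h : 16 * r * (t + r + 1) ≤ n) :
    (1 / 4 : ℝ) ^ t * (1 / (32 * r)) ^ r ≤
      prob fun π : Equiv.Perm (Fin n) => r * (n / 8 * t) ≤ work (pile n) π := by
  -- The `r` blocks fill at most the top `n / 8` indices, leaving room for `n / 8` waiting upper
  -- segments. The size hypothesis keeps the prefix so short that at least `n / (32 r)` values of
  -- each block remain available.
  obtain ⟨w, hrw, hw'⟩ : ∃ w, r * w ≤ n / 8 ∧ n < 8 * r * (w + 1) := by
    refine ⟨n / (8 * r), ?_, Nat.lt_mul_div_succ _ (by omega)⟩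
    rw [← Nat.div_div_eq_div_mul]
    exact Nat.mul_div_le _ _
  have htr : 16 * (t + r + 1) ≤ n :=
    le_trans (Nat.mul_le_mul_right _ (by omega)) h
  have hr0 : (0 : ℝ) < r := by exact_mod_cast hr
  refine le_prob (P := prefixIn (schedule n t w) (t + r)) ?_ fun π hπ =>
    mul_le_work_of_schedule (by omega) (by omega) hπ
  have hprod : (1 / 4 : ℝ) ^ t * (1 / (32 * r)) ^ r =
      ∏ i ∈ Finset.range (t + r), if i < t then (1 / 4 : ℝ) else 1 / (32 * r) := by
    rw [Finset.prod_range_add, Finset.prod_congr rfl fun i hi =>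
      if_pos (Finset.mem_range.1 hi), Finset.prod_const, Finset.card_range]
    simp
  rw [hprod]
  refine factorial_mul_prod_le_card_prefixIn _ _ (fun i => ?_) (by omega) fun i hi => ?_
  · split_ifs <;> positivity
  · rw [schedule]
    split_ifs with hit
    · rw [card_lowers]
      have : n ≤ 4 * (n - n / 2 - i) := by omega
      have : (n : ℝ) ≤ 4 * ((n - n / 2 - i : ℕ) : ℝ) := by exact_mod_cast this
      linarith
    · have h1 : (i - t + 1) * w ≤ r * w := Nat.mul_le_mul_right w (by omega)
      have h2 : (i - t + 1) * w = (i - t) * w + w := by ring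
      have hcard : (Finset.univ.filter fun j : Fin n =>
          n ≤ j + (i - t + 1) * w ∧ j + (i - t) * w < n).card = w := by
        have h3 : (Finset.univ.filter fun j : Fin n =>
          n ≤ j + (i - t + 1) * w ∧ j + (i - t) * w < n).map Fin.valEmbedding =
            Finset.Ico (n - (i - t + 1) * w) (n - (i - t) * w) := by
          ext k
          simp only [Finset.mem_map, Finset.mem_filter, Finset.mem_univ, true_and,
            Fin.valEmbedding_apply, Finset.mem_Ico]
          constructor
          · rintro ⟨j, ⟨h4, h5⟩, rfl⟩
            omega
          · rintro ⟨h4, h5⟩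
            exact ⟨⟨k, by omega⟩, ⟨by simp only; omega, by simp only; omega⟩, rfl⟩
        rw [← Finset.card_map, h3, Nat.card_Ico]
        omega
      rw [hcard]
      have h5 : i + 1 ≤ t + r := hi
      have h6 : n ≤ 32 * r * (w - i) := by
        have h7 : 16 * r * (i + 2) ≤ n := le_trans (Nat.mul_le_mul_left _ (by omega)) h
        have h8 : i ≤ w := by
          by_contra! h9
          have : 8 * r * (w + 1) ≤ 16 * r * (i + 2) := by
            refine Nat.mul_le_mul ?_ ?_ <;> omega
          omega
        obtain ⟨v, rfl⟩ := Nat.exists_eq_add_of_le h8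
        rw [Nat.add_sub_cancel_left]
        nlinarith
      have h9 : (n : ℝ) ≤ 32 * r * ((w - i : ℕ) : ℝ) := by exact_mod_cast h6
      rw [one_div, inv_mul_le_iff₀ (by positivity)]
      exact h9

/-- Applied with `L = log n` and `M = log log n` in the regime `c M > L`, with `t = ⌈c⌉` and `r =
⌈M⌉`. From `128 M³ ≤ L < c M` one gets `32 r² ≤ c`, so the crude bound `32 r ≤ exp (32 r)` already
gives `(1 / (32 r))^r ≥ exp (-c)`. Together with `(1/4)^t ≥ exp (-2 (c + 1))` this leaves room
within the exponent `20 c`. -/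
theorem tail_of_bounds {c L M : ℝ} (hn : 16 ≤ n) (hc : 0 ≤ c) (hM : 1 ≤ M) (hML : M ≤ L)
    (hcL : L < c * M) (hM3 : 128 * M ^ 3 ≤ L) (hcn : c ≤ Real.sqrt n)
    (hL : 200 * L ≤ Real.sqrt n) :
    Real.exp (-2) * Real.exp (-20 * c) ≤ prob fun π : Equiv.Perm (Fin n) =>
      1 / 16 * (c * n * M) ≤ (work (pile n) π : ℝ) := by
  set t := ⌈c⌉₊
  set r := ⌈M⌉₊
  have ht1 : c ≤ t := Nat.le_ceil c
  have ht2 : (t : ℝ) < c + 1 := Nat.ceil_lt_add_one hc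
  have hr1 : M ≤ r := Nat.le_ceil M
  have hr2 : (r : ℝ) < M + 1 := Nat.ceil_lt_add_one (by linarith)
  have hr : 1 ≤ r := by
    have : (1 : ℝ) ≤ r := hM.trans hr1
    exact_mod_cast this
  have hsq : Real.sqrt n * Real.sqrt n = n := Real.mul_self_sqrt (Nat.cast_nonneg n)
  have hn' : (16 : ℝ) ≤ n := by exact_mod_cast hn
  have hcond : 16 * r * (t + r + 1) ≤ n := by
    have h1 : (16 : ℝ) * r * (t + r + 1) ≤ n := by
      calc (16 : ℝ) * r * (t + r + 1) ≤ (1 / 2 * Real.sqrt n) * (2 * Real.sqrt n) := by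
            refine mul_le_mul ?_ ?_ (by positivity) (by positivity) <;> linarith
        _ = n := by linarith
    exact_mod_cast h1
  refine le_trans ?_ ((schedule_prob hr hcond).trans (prob_mono fun π hπ => ?_))
  · have h1 : Real.exp (-2 * (c + 1)) ≤ (1 / 4 : ℝ) ^ t := by
      have h2 : Real.exp (-2) ≤ 1 / 4 := by
        rw [Real.exp_neg, ← one_div]
        refine one_div_le_one_div_of_le (by norm_num) ?_
        have := Real.add_one_le_exp (1 : ℝ)
        have h3 : Real.exp 2 = Real.exp 1 * Real.exp 1 := by rw [← Real.exp_add]; norm_num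
        rw [h3]
        nlinarith
      calc Real.exp (-2 * (c + 1)) ≤ Real.exp (t * (-2)) := Real.exp_le_exp.2 (by linarith)
        _ = Real.exp (-2) ^ t := Real.exp_nat_mul _ _
        _ ≤ _ := pow_le_pow_left₀ (Real.exp_pos _).le h2 t
    have h2 : Real.exp (-c) ≤ (1 / (32 * r) : ℝ) ^ r := by
      have h3 : Real.exp (-(32 * r)) ≤ 1 / (32 * r) := by
        rw [Real.exp_neg, ← one_div]
        refine one_div_le_one_div_of_le (by positivity) ?_
        linarith [Real.add_one_le_exp (32 * (r : ℝ))]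
      have h4 : (r : ℝ) * (32 * r) ≤ c := by
        have h5 : (r : ℝ) ≤ 2 * M := by linarith
        have h6 : (r : ℝ) * r ≤ 2 * M * (2 * M) :=
          mul_le_mul h5 h5 (Nat.cast_nonneg _) (by linarith)
        have h7 : 128 * M ^ 2 * M < c * M := by
          calc 128 * M ^ 2 * M = 128 * M ^ 3 := by ring
            _ ≤ L := hM3
            _ < c * M := hcL
        have h8 := lt_of_mul_lt_mul_right h7 (by linarith)
        nlinarith
      calc Real.exp (-c) ≤ Real.exp (r * (-(32 * r))) := Real.exp_le_exp.2 (by linarith)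
        _ = Real.exp (-(32 * r)) ^ r := Real.exp_nat_mul _ _
        _ ≤ _ := pow_le_pow_left₀ (Real.exp_pos _).le h3 r
    calc Real.exp (-2) * Real.exp (-20 * c) = Real.exp (-2 + -20 * c) := (Real.exp_add _ _).symm
      _ ≤ Real.exp (-2 * (c + 1) + -c) := Real.exp_le_exp.2 (by linarith)
      _ = Real.exp (-2 * (c + 1)) * Real.exp (-c) := Real.exp_add _ _
      _ ≤ _ := mul_le_mul h1 h2 (Real.exp_pos _).le (by positivity)
  · have h1 : ((r * (n / 8 * t) : ℕ) : ℝ) ≤ (work (pile n) π : ℝ) := Nat.cast_le.2 hπ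
    refine le_trans ?_ h1
    have h2 : (n : ℝ) / 16 ≤ ((n / 8 : ℕ) : ℝ) := by
      have : n ≤ 16 * (n / 8) := by omega
      have : (n : ℝ) ≤ 16 * ((n / 8 : ℕ) : ℝ) := by exact_mod_cast this
      linarith
    rw [Nat.cast_mul, Nat.cast_mul]
    calc 1 / 16 * (c * n * M) = M * (n / 16 * c) := by ring
      _ ≤ _ := by gcongr

theorem eventually_tail : ∀ c : ℕ → ℝ, (∀ n, 0 ≤ c n) →
    (c =o[atTop] fun n : ℕ => Real.sqrt (n : ℝ)) →
    ∀ᶠ n : ℕ in atTop, Real.exp (-2) * Real.exp (-20 * c n) ≤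
      prob (fun π : Equiv.Perm (Fin n) =>
        1 / 16 * (c n * n * Real.log (Real.log n)) ≤ (work (pile n) π : ℝ)) := by
  intro c hc hco
  have hlog : Tendsto (fun n : ℕ => Real.log n) atTop atTop :=
    Real.tendsto_log_atTop.comp tendsto_natCast_atTop_atTop
  have hloglog : Tendsto (fun n : ℕ => Real.log (Real.log n)) atTop atTop :=
    Real.tendsto_log_atTop.comp hlog
  have h1 : ∀ᶠ n : ℕ in atTop, c n ≤ Real.sqrt n := by
    filter_upwards [hco.bound one_pos] with n hn
    rw [one_mul, Real.norm_of_nonneg (hc n), Real.norm_of_nonneg (Real.sqrt_nonneg _)] at hn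
    exact hn
  have h2 : ∀ᶠ n : ℕ in atTop, 128 * Real.log (Real.log n) ^ 3 ≤ Real.log n := by
    have := (Real.isLittleO_pow_log_id_atTop (n := 3)).bound (show (0 : ℝ) < 1 / 128 by norm_num)
    filter_upwards [hlog.eventually this, hloglog.eventually_ge_atTop 0,
      hlog.eventually_ge_atTop 0] with n h h' h''
    rw [Real.norm_of_nonneg (pow_nonneg h' 3), id, Real.norm_of_nonneg h''] at h
    linarith
  have h3 : ∀ᶠ n : ℕ in atTop, 200 * Real.log n ≤ Real.sqrt n := by
    have := (isLittleO_log_rpow_atTop (show (0 : ℝ) < 1 / 2 by norm_num)).bound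
      (show (0 : ℝ) < 1 / 200 by norm_num)
    filter_upwards [tendsto_natCast_atTop_atTop.eventually this,
      hlog.eventually_ge_atTop 0] with n h h'
    rw [← Real.sqrt_eq_rpow, Real.norm_of_nonneg h',
      Real.norm_of_nonneg (Real.sqrt_nonneg _)] at h
    linarith
  filter_upwards [h1, h2, h3, eventually_le_work, hloglog.eventually_ge_atTop 1,
    hlog.eventually_ge_atTop 1, eventually_ge_atTop 16] with n h1 h2 h3 h4 h5 h6 h7
  -- If `c log log n ≤ log n`, the bound valid for every order gives probability one; otherwise the
  -- schedule takes over.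
  rcases le_or_gt (c n * Real.log (Real.log n)) (Real.log n) with h | h
  · have h8 : Real.exp (-2) * Real.exp (-20 * c n) ≤ 1 := by
      rw [← Real.exp_add, Real.exp_le_one_iff]
      linarith [hc n]
    refine h8.trans (one_le_prob fun π => le_trans ?_ (h4 π))
    have := mul_le_mul_of_nonneg_left h (Nat.cast_nonneg (α := ℝ) n)
    linarith
  · exact tail_of_bounds h7 (hc n) h5
      ((Real.log_le_sub_one_of_pos (by linarith)).trans (by linarith)) h h2 h1 h3

theorem isLittleO_const_mul_log_sqrt (a : ℝ) :
    (fun n : ℕ => a * Real.log n) =o[atTop] fun n : ℕ => Real.sqrt (n : ℝ) := by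
  have h := (isLittleO_log_rpow_atTop (show (0 : ℝ) < 1 / 2 by norm_num)).comp_tendsto
    (tendsto_natCast_atTop_atTop (R := ℝ))
  refine (h.const_mul_left a).congr (fun n => rfl) fun n => ?_
  rw [Function.comp_apply, Real.sqrt_eq_rpow]

theorem eventually_log_tail : ∃ K K' : ℝ, 0 < K ∧ 0 < K' ∧
    ∀ᶠ n : ℕ in atTop, K' * (1 / Real.sqrt (n : ℝ)) ≤
      prob (fun π : Equiv.Perm (Fin n) =>
        K * (n * Real.log n * Real.log (Real.log n)) ≤ (work (pile n) π : ℝ)) := by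
  refine ⟨1 / 640, Real.exp (-2), by norm_num, Real.exp_pos _, ?_⟩
  -- This `c` makes `exp (-20 c) = n ^ (-1/2)`, and 1/640 = 1/16 · 1/40.
  filter_upwards [eventually_tail (fun n => 1 / 40 * Real.log n)
    (fun n => mul_nonneg (by norm_num) (Real.log_natCast_nonneg n))
    (isLittleO_const_mul_log_sqrt _), eventually_gt_atTop 0] with n h hn
  have hpos : (0 : ℝ) < n := by exact_mod_cast hn
  convert h using 2
  · rw [one_div, Real.sqrt_eq_rpow, ← Real.rpow_neg hpos.le, Real.rpow_def_of_pos hpos]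
    congr 1
    ring
  · ext π
    rw [show 1 / 640 * (n * Real.log n * Real.log (Real.log n)) =
      1 / 16 * (1 / 40 * Real.log n * n * Real.log (Real.log n)) by ring]

theorem eventually_rpow_le_prob (C : ℝ) {ε : ℝ} (hε : 0 < ε) :
    ∀ᶠ n : ℕ in atTop, (n : ℝ) ^ (-ε) ≤ prob (fun π : Equiv.Perm (Fin n) =>
      C * (n * Real.log n) ≤ (work (pile n) π : ℝ)) := by
  have hlog : Tendsto (fun n : ℕ => Real.log n) atTop atTop :=
    Real.tendsto_log_atTop.comp tendsto_natCast_atTop_atTop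
  -- The probability becomes `exp (-2) * n ^ (-ε/2)`. The threshold `log n ≥ 4 / ε` absorbs `exp
  -- (-2)` into the spare `n ^ (-ε/2)`, and `log log n ≥ 640 C / ε` absorbs the constant `C`.
  filter_upwards [eventually_tail (fun n => ε / 40 * Real.log n)
    (fun n => mul_nonneg (by positivity) (Real.log_natCast_nonneg n))
    (isLittleO_const_mul_log_sqrt _), eventually_gt_atTop 0,
    hlog.eventually_ge_atTop (4 / ε),
    (Real.tendsto_log_atTop.comp hlog).eventually_ge_atTop (640 * C / ε)] with n h hn h1 h2
  have hpos : (0 : ℝ) < n := by exact_mod_cast hn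
  have hL : 0 ≤ Real.log n := Real.log_natCast_nonneg n
  refine le_trans ?_ (h.trans (prob_mono fun π hπ => le_trans ?_ hπ))
  · rw [← Real.exp_add, Real.rpow_def_of_pos hpos, Real.exp_le_exp]
    rw [div_le_iff₀ hε] at h1
    linarith
  · rw [Function.comp_apply, div_le_iff₀ hε] at h2
    have := mul_le_mul_of_nonneg_left h2 (mul_nonneg hpos.le hL)
    linarith

theorem eventually_rpow_le_prob_expectedWork {C ε : ℝ} (hC : 0 < C) (hε : 0 < ε) :
    ∀ᶠ n : ℕ in atTop, (n : ℝ) ^ (-ε) ≤ prob (fun π : Equiv.Perm (Fin n) =>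
      C * expectedWork (pile n) ≤ (work (pile n) π : ℝ)) := by
  have hlog : Tendsto (fun n : ℕ => Real.log n) atTop atTop :=
    Real.tendsto_log_atTop.comp tendsto_natCast_atTop_atTop
  -- For `log n ≥ 1` the mean is at most `26 n (1 + log n) ≤ 52 n log n`.
  filter_upwards [eventually_rpow_le_prob (52 * C) hε,
    hlog.eventually_ge_atTop 1, eventually_ne_atTop 0] with n h h1 hn
  refine h.trans (prob_mono fun π hπ => le_trans ?_ hπ)
  calc C * expectedWork (pile n) ≤ C * (26 * (n * (1 + Real.log n))) :=
        mul_le_mul_of_nonneg_left (expectedWork_le hn) hC.le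
    _ ≤ C * (26 * (n * (Real.log n + Real.log n))) := by gcongr
    _ = _ := by ring

end VisibilityRIC

theorem mainTheorem2 :
    ∃ S : ∀ n : ℕ, Fin n → HSegment,
      (∀ n : ℕ, NonIntersecting (S n) ∧ GeneralPosition (S n) ∧ IsTwoPiles (S n)) ∧
      (∃ K K' : ℝ, 0 < K ∧ 0 < K' ∧
        ∀ c : ℕ → ℝ, (∀ n, 0 ≤ c n) → (c =o[atTop] fun n : ℕ => Real.sqrt (n : ℝ)) →
          ∀ᶠ n : ℕ in atTop,
            K' * Real.exp (-20 * c n) ≤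
              prob (fun π : Equiv.Perm (Fin n) =>
                K * (c n * n * Real.log (Real.log n)) ≤ (work (S n) π : ℝ))) ∧
      (∃ K K' : ℝ, 0 < K ∧ 0 < K' ∧
        ∀ᶠ n : ℕ in atTop,
          K' * (1 / Real.sqrt (n : ℝ)) ≤
            prob (fun π : Equiv.Perm (Fin n) =>
              K * (n * Real.log n * Real.log (Real.log n)) ≤ (work (S n) π : ℝ))) ∧
      (∀ C ε : ℝ, 0 < C → 0 < ε →
        ∀ᶠ n : ℕ in atTop,
          (n : ℝ) ^ (-ε) ≤
            prob (fun π : Equiv.Perm (Fin n) =>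
              C * (n * Real.log n) ≤ (work (S n) π : ℝ)) ∧
          (n : ℝ) ^ (-ε) ≤
            prob (fun π : Equiv.Perm (Fin n) =>
              C * expectedWork (S n) ≤ (work (S n) π : ℝ))) := by
  exact ⟨pile, fun n => ⟨pile_nonIntersecting n, pile_generalPosition n, pile_isTwoPiles n⟩,
    ⟨1 / 16, Real.exp (-2), by norm_num, Real.exp_pos _, eventually_tail⟩, eventually_log_tail,
    fun C ε hC hε => (eventually_rpow_le_prob C hε).and
      (eventually_rpow_le_prob_expectedWork hC hε)⟩
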